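/- Let $\mathbb{D}=\{z\in\mathbb{C}:|z|<1\}$, $\mathbb{N}=\{1,2,\dots\}$ and $\mathbb{N}_0=\mathbb{N}\cup\{0\}$. For a doubly indexed family $X_{n,N}$ in a topological space and $s\ge 0$, write $\lim_{n/N\to s}X_{n,N}=X$ if $\lim_{j\to\infty}X_{n_j,N_j}=X$ for all sequences $n_j,N_j\in\mathbb{N}$ with $n_j\to\infty$, $N_j\to\infty$ and $n_j/N_j\to s$. Given $\{\alpha_{n,N}\mid n,N\in\mathbb{N}_0\}\subset\mathbb{D}$, define for each $N$ the monic polynomials $\Phi_{n,N}$ of degree $n$ by $\Phi_{0,N}=1$ and $$\Phi_{n+1,N}(z)=z\,\Phi_{n,N}(z)-\overline{\alpha_{n,N}}\,\Phi_{n,N}^{*}(z),\qquad \Phi_{n,N}^{*}(z)=z^{n}\,\overline{\Phi_{n,N}(1/\bar z)},\qquad n\ge 0,$$ and, for $|\beta|=1$, the paraorthogonal polynomials $$\Phi^{(\beta)}_{n+1,N}(z)=z\,\Phi_{n,N}(z)-\bar\beta\,\Phi^{*}_{n,N}(z),\qquad n\ge 0.$$ For $n\ge1$ let $\nu^{(\beta)}_{n,N}=\frac1n\sum_{j=1}^{n}\delta_{z_j}$,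 where $z_1,\dots,z_n$ are the zeros of $\Phi^{(\beta)}_{n,N}$ counted with multiplicity. For $0\le a<1$ put $\theta_a=2\arcsin a$ and let $\nu_a$ be the measure on the arc $\Gamma_a=\{e^{i\theta}\mid\theta_a\le\theta\le2\pi-\theta_a\}$ with $$\frac{d\nu_a}{d\theta}(e^{i\theta})=\frac1{2\pi}\,\frac{\sin(\theta/2)}{\sqrt{\cos^2(\theta_a/2)-\cos^2(\theta/2)}},\qquad \theta_a<\theta<2\pi-\theta_a,$$ and let $\nu_1=\delta_{-1}$. Theorem. Let $t>0$, let $\alpha:[0,t]\to\overline{\mathbb{D}}$ be Lebesgue measurable, and let $\{\alpha_{n,N}\mid n,N\in\mathbb{N}_0\}\subset\mathbb{D}$ satisfy $$\lim_{n/N\to s}\alpha_{n,N}=\alpha(s)\qquad\text{for a.e. } s\in[0,t].$$ Then the average $\sigma_t=\frac1t\int_0^t\nu_{|\alpha(s)|}\,ds$, that is, $\sigma_t(B)=\frac1t\int_0^t\nu_{|\alpha(s)|}(B)\,ds$ for Borel sets $B\subseteq\mathbb{C}$, is a well-defined probability measure, and for every $\beta\in\mathbb{C}$ with $|\beta|=1$,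 $$\lim_{n/N\to t}\nu^{(\beta)}_{n,N}=\sigma_t$$ in the weak topology of finite measures on $\mathbb{C}$, i.e. tested against bounded continuous functions. -/

import Mathlib

open MeasureTheory Filter Topology Polynomial
open scoped NNReal ENNReal

noncomputable section

namespace VaryingPOPUC

/-- `lim_{n/N → t} X_{n,N} = L`: the limit is `L` along all sequences `n_j, N_j → ∞` of naturals
with `n_j / N_j → t`. -/
def RatioTendsto {E : Type*} [TopologicalSpace E] (X : ℕ → ℕ → E) (t : ℝ) (L : E) : Prop :=
  ∀ n N : ℕ → ℕ, Tendsto n atTop atTop → Tendsto N atTop atTop →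
    Tendsto (fun j => (n j : ℝ) / (N j : ℝ)) atTop (𝓝 t) →
    Tendsto (fun j => X (n j) (N j)) atTop (𝓝 L)

/-- The reversed polynomial `z ^ n * conj (p (1 / conj z))` of a polynomial `p` of degree at
most `n`: the `k`-th coefficient is the conjugate of the `(n - k)`-th coefficient of `p`. -/
def revPoly (n : ℕ) (p : ℂ[X]) : ℂ[X] :=
  (p.map (starRingEnd ℂ)).reflect n

/-- The monic orthogonal polynomials on the unit circle with Verblunsky coefficients `a`,
generated by the Szegő recurrence. -/
def opuc (a : ℕ → ℂ) : ℕ → ℂ[X]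
  | 0 => 1
  | n + 1 => X * opuc a n - C (starRingEnd ℂ (a n)) * revPoly n (opuc a n)

/-- The paraorthogonal polynomials with Verblunsky coefficients `a` and parameter `β`. -/
def popuc (a : ℕ → ℂ) (β : ℂ) : ℕ → ℂ[X]
  | 0 => 1
  | n + 1 => X * opuc a n - C (starRingEnd ℂ β) * revPoly n (opuc a n)

/-- The unit mass at `z`. -/
def diracMass (z : ℂ) : FiniteMeasure ℂ :=
  ⟨Measure.dirac z, inferInstance⟩

/-- The zero-counting measure `(1 / n) ∑ δ_{z_j}` of the `n`-th paraorthogonal polynomial,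
the sum running over its zeros with multiplicity. -/
def popucZeroMeasure (a : ℕ → ℂ) (β : ℂ) (n : ℕ) : FiniteMeasure ℂ :=
  (n : ℝ≥0)⁻¹ • ((popuc a β n).roots.map diracMass).sum

/-- The angle `θ_a = 2 arcsin a`. -/
def arcAngle (a : ℝ) : ℝ := 2 * Real.arcsin a

/-- The density of `ν_a` with respect to `dθ` on `[θ_a, 2π - θ_a]`, for `0 ≤ a < 1`. -/
def arcDensity (a θ : ℝ) : ℝ :=
  1 / (2 * Real.pi) *
    (Real.sin (θ / 2) / √(Real.cos (arcAngle a / 2) ^ 2 - Real.cos (θ / 2) ^ 2))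

/-- The measure `ν_a`, `0 ≤ a ≤ 1`, on the arc `Γ_a = {e^{iθ} : θ_a ≤ θ ≤ 2π - θ_a}`, as a
measure on `ℂ`; for `a = 1` it is the unit mass at `-1`. -/
def arcMeasure (a : ℝ) : Measure ℂ :=
  if a = 1 then Measure.dirac (-1)
  else Measure.map (fun θ : ℝ => Complex.exp (θ * Complex.I))
    ((volume.restrict (Set.Icc (arcAngle a) (2 * Real.pi - arcAngle a))).withDensity
      (fun θ => ENNReal.ofReal (arcDensity a θ)))

/-- The average `(1 / t) ∫_0^t ν_{|α(s)|} ds`, i.e. the measure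
`B ↦ (1 / t) ∫_0^t ν_{|α(s)|}(B) ds`. -/
def averageArcMeasure (t : ℝ) (α : ℝ → ℂ) : Measure ℂ :=
  ENNReal.ofReal t⁻¹ •
    Measure.bind (volume.restrict (Set.Icc 0 t)) (fun s => arcMeasure ‖α s‖)

end VaryingPOPUC

end

noncomputable section

namespace VaryingPOPUC

local notation "conj" => starRingEnd ℂ
local notation "𝕏" => (PowerSeries.X : PowerSeries ℂ)
local notation "𝕔" => (PowerSeries.C : ℂ →+* PowerSeries ℂ)
local notation "𝔡" => PowerSeries.derivative ℂ

/-! All measures involved live on the unit circle, where trigonometric polynomials are dense, so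
convergence of moments suffices (`tendsto_of_tendsto_moments`). With `f_n = Φ_n / Φ_n^*` expanded at
the origin, the Szegő recurrence reads `Φ_{n+1}^* = Φ_n^* (1 - α_n z f_n)`. Hence minus the
logarithmic derivative of `Φ_n^* = ∏ (1 - conj z_j z)`, whose coefficients are the power sums of the
conjugated zeros, is a sum with one term per step (`sum_conj_pow_roots_opuc`). A paraorthogonal
polynomial is the case where the last coefficient is `β`; this alters one bounded summand and costs
`O(1/n)` in the moments.

By the Schur step `f_{n+1} = (z f_n - conj α_n) / (1 - α_n z f_n)`, the `k`-th coefficient of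
`f_{n+1}` depends only on `α_n` and the coefficients of `f_n` below `k`. So if `α_{n,N} → c` as `n/N
→ s`, every coefficient tends to that of a fixed point of the limiting step. Dominated convergence
turns averages over steps into an integral over `s` (`ratioTendsto_average`).

The limit must be matched with the moments of `ν_a`, `a = |c|`. The fixed point solves a quadratic
with discriminant `(1+z)^2 - 4(1-a^2)z`, and the moment generating function becomes `(1-z)` over its
square root (`coeff_succ_koebeTransform_eq`). On the other side, `cos (θ/2) = √(1-a^2) sin φ` makes
`ν_a` the image of a uniform law (`arcMeasure_eq_map`). Expanding the Poisson kernel in powers of `2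
+ w + conj w = 4(1-a^2) sin^2 φ` and averaging gives central binomial coefficients, hence the same
function. -/

/-! ### Reversed polynomials and the Szegő recurrence -/

lemma coeff_revPoly_of_le {n k : ℕ} (p : ℂ[X]) (hk : k ≤ n) :
    (revPoly n p).coeff k = conj (p.coeff (n - k)) := by
  simp [revPoly, coeff_reflect, revAt_le hk]

lemma coeff_revPoly_of_lt {n k : ℕ} {p : ℂ[X]} (hp : p.natDegree ≤ n) (hk : n < k) :
    (revPoly n p).coeff k = 0 := by
  rw [revPoly, coeff_reflect, revAt_eq_self_of_lt hk, coeff_map,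
    coeff_eq_zero_of_natDegree_lt (by omega), map_zero]

lemma natDegree_revPoly_le {n : ℕ} {p : ℂ[X]} (hp : p.natDegree ≤ n) :
    (revPoly n p).natDegree ≤ n :=
  natDegree_le_iff_coeff_eq_zero.2 fun _ hk => coeff_revPoly_of_lt hp hk

/-- The reversed form of the Szegő recurrence. -/
lemma revPoly_szego {n : ℕ} {p : ℂ[X]} (hp : p.natDegree ≤ n) (c : ℂ) :
    revPoly (n + 1) (X * p - C (conj c) * revPoly n p) = revPoly n p - C c * (X * p) := by
  ext k
  rcases Nat.lt_or_ge (n + 1) k with hk | hk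
  · have hd : (X * p - C (conj c) * revPoly n p).natDegree ≤ n + 1 := by
      refine (natDegree_sub_le _ _).trans (max_le ?_ ?_)
      · exact natDegree_mul_le.trans (by rw [natDegree_X]; omega)
      · exact (natDegree_C_mul_le _ _).trans ((natDegree_revPoly_le hp).trans (Nat.le_succ n))
    obtain ⟨m, rfl⟩ : ∃ m, k = m + 1 := ⟨k - 1, by omega⟩
    rw [coeff_revPoly_of_lt hd hk, coeff_sub, coeff_C_mul, coeff_X_mul,
      coeff_revPoly_of_lt hp (by omega), coeff_eq_zero_of_natDegree_lt (by omega)]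
    simp
  · rw [coeff_revPoly_of_le _ hk]
    rcases Nat.eq_zero_or_pos k with rfl | hk0
    · simp [coeff_revPoly_of_le, coeff_revPoly_of_lt hp]
    · obtain ⟨m, rfl⟩ : ∃ m, k = m + 1 := ⟨k - 1, by omega⟩
      rw [Nat.add_sub_add_right, coeff_sub, coeff_C_mul, coeff_revPoly_of_le _ (Nat.sub_le n m),
        Nat.sub_sub_self (by omega), coeff_sub, coeff_C_mul, coeff_X_mul]
      rcases Nat.lt_or_ge m n with hm | hm
      · rw [coeff_revPoly_of_le _ hm]
        obtain ⟨q, hq⟩ : ∃ q, n - m = q + 1 := ⟨n - m - 1, by omega⟩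
        rw [hq, coeff_X_mul, show n - (m + 1) = q by omega]
        simp
      · obtain rfl : m = n := by omega
        rw [coeff_revPoly_of_lt hp (Nat.lt_succ_self m)]
        simp

lemma natDegree_opuc_le (a : ℕ → ℂ) (n : ℕ) : (opuc a n).natDegree ≤ n := by
  induction n with
  | zero => simp [opuc]
  | succ n ih =>
    refine (natDegree_sub_le _ _).trans (max_le ?_ ?_)
    · exact natDegree_mul_le.trans (by rw [natDegree_X]; omega)
    · exact (natDegree_C_mul_le _ _).trans ((natDegree_revPoly_le ih).trans (Nat.le_succ n))

lemma coeff_opuc_self (a : ℕ → ℂ) (n : ℕ) : (opuc a n).coeff n = 1 := by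
  induction n with
  | zero => simp [opuc]
  | succ n ih =>
    rw [opuc, coeff_sub, coeff_X_mul, ih, coeff_C_mul,
      coeff_revPoly_of_lt (natDegree_opuc_le a n) (Nat.lt_succ_self n)]
    simp

lemma natDegree_opuc (a : ℕ → ℂ) (n : ℕ) : (opuc a n).natDegree = n :=
  natDegree_eq_of_le_of_coeff_ne_zero (natDegree_opuc_le a n) (by simp [coeff_opuc_self])

lemma monic_opuc (a : ℕ → ℂ) (n : ℕ) : (opuc a n).Monic := by
  rw [Monic, leadingCoeff, natDegree_opuc, coeff_opuc_self]

lemma revPoly_opuc_succ (a : ℕ → ℂ) (n : ℕ) :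
    revPoly (n + 1) (opuc a (n + 1)) =
      revPoly n (opuc a n) - C (a n) * (X * opuc a n) :=
  revPoly_szego (natDegree_opuc_le a n) (a n)

lemma opuc_congr {a b : ℕ → ℂ} {n : ℕ} (h : ∀ k < n, a k = b k) : opuc a n = opuc b n := by
  induction n with
  | zero => rfl
  | succ n ih =>
    rw [opuc, opuc, ih fun k hk => h k (hk.trans n.lt_succ_self), h n n.lt_succ_self]

/-- A paraorthogonal polynomial is generated by the Szegő recurrence whose last coefficient is
replaced by `β`. -/
lemma popuc_succ_eq_opuc (a : ℕ → ℂ) (β : ℂ) (n : ℕ) :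
    popuc a β (n + 1) = opuc (Function.update a n β) (n + 1) := by
  rw [popuc, opuc, Function.update_self,
    opuc_congr (a := Function.update a n β) (b := a) fun k hk => Function.update_of_ne hk.ne _ _]

/-! ### Location of the zeros -/

/-- With `x = z Φ_n` and `y = Φ_n^*`, this carries `|Φ_n| ≤ |Φ_n^*|` through a recurrence step. -/
lemma norm_mobius_sq_sub (x y c : ℂ) :
    ‖y - c * x‖ ^ 2 - ‖x - conj c * y‖ ^ 2 = (1 - ‖c‖ ^ 2) * (‖y‖ ^ 2 - ‖x‖ ^ 2) := by
  simp only [← Complex.normSq_eq_norm_sq, Complex.normSq_apply, Complex.sub_re, Complex.sub_im,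
    Complex.mul_re, Complex.mul_im, Complex.conj_re, Complex.conj_im]
  ring

/-- In the open unit disc the reversed polynomial has no zeros and dominates the polynomial. -/
lemma revPoly_opuc_dominates {a : ℕ → ℂ} (n : ℕ) (ha : ∀ k < n, ‖a k‖ ≤ 1) {z : ℂ}
    (hz : ‖z‖ < 1) :
    (revPoly n (opuc a n)).eval z ≠ 0 ∧
      ‖(opuc a n).eval z‖ ≤ ‖(revPoly n (opuc a n)).eval z‖ := by
  induction n with
  | zero => simp [opuc, revPoly]
  | succ n ih =>
    obtain ⟨h0, hle⟩ := ih fun k hk => ha k (hk.trans n.lt_succ_self)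
    have han := ha n n.lt_succ_self
    rw [revPoly_opuc_succ, opuc]
    simp only [eval_sub, eval_mul, eval_C, eval_X]
    set x := (opuc a n).eval z
    set y := (revPoly n (opuc a n)).eval z
    have hy : 0 < ‖y‖ := norm_pos_iff.2 h0
    -- Strict because `|z| < 1`; this keeps `Φ^*` nonvanishing even if `|a n| = 1`, so `β` is
    -- allowed as a coefficient.
    have hzx : ‖z * x‖ < ‖y‖ := by
      rw [norm_mul]
      nlinarith [norm_nonneg x, norm_nonneg z]
    constructor
    · intro h
      have h1 : ‖y‖ = ‖a n * (z * x)‖ := by rw [sub_eq_zero.1 h]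
      rw [norm_mul] at h1
      nlinarith [norm_nonneg (z * x)]
    · have h1 := norm_mobius_sq_sub (z * x) y (a n)
      have h2 : 0 ≤ (1 - ‖a n‖ ^ 2) * (‖y‖ ^ 2 - ‖z * x‖ ^ 2) := by
        apply mul_nonneg
        · nlinarith [norm_nonneg (a n)]
        · nlinarith [norm_nonneg (z * x)]
      exact le_of_sq_le_sq (by linarith) (norm_nonneg _)

lemma revPoly_popuc (a : ℕ → ℂ) {β : ℂ} (hβ : ‖β‖ = 1) (n : ℕ) :
    revPoly (n + 1) (popuc a β (n + 1)) = C (-β) * popuc a β (n + 1) := by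
  have h : C β * C (conj β) = (1 : ℂ[X]) := by
    rw [← C_mul, Complex.mul_conj, Complex.normSq_eq_norm_sq, hβ]; simp
  rw [popuc, revPoly_szego (natDegree_opuc_le a n), C_neg]
  linear_combination (-(revPoly n (opuc a n))) * h

lemma eval_revPoly {n : ℕ} {p : ℂ[X]} (hp : p.natDegree ≤ n) {z : ℂ} (hz : z ≠ 0) :
    (revPoly n p).eval (conj z)⁻¹ = 0 ↔ p.eval z = 0 := by
  have hz' : conj z ≠ 0 := (_root_.map_ne_zero _).2 hz
  let := invertibleOfNonzero hz'
  have h := eval₂_reflect_eq_zero_iff (RingHom.id ℂ) (conj z) n (p.map (starRingEnd ℂ))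
    (natDegree_map_le.trans hp)
  rw [invOf_eq_inv] at h
  rw [revPoly, ← eval₂_id, h, eval₂_id, eval_map, eval₂_at_apply, map_eq_zero]

/-- The zeros of a paraorthogonal polynomial lie on the unit circle. -/
lemma norm_eq_one_of_mem_roots_popuc {a : ℕ → ℂ} (ha : ∀ k, ‖a k‖ ≤ 1) {β : ℂ} (hβ : ‖β‖ = 1)
    {n : ℕ} {z : ℂ} (hz : z ∈ (popuc a β n).roots) : ‖z‖ = 1 := by
  cases n with
  | zero => simp [popuc] at hz
  | succ n =>
    have hz0 : (popuc a β (n + 1)).eval z = 0 := (mem_roots'.1 hz).2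
    have hne : ∀ w : ℂ, ‖w‖ < 1 → (revPoly (n + 1) (popuc a β (n + 1))).eval w ≠ 0 := by
      intro w hw
      rw [popuc_succ_eq_opuc]
      refine (revPoly_opuc_dominates (n + 1) (fun k _ => ?_) hw).1
      by_cases hk : k = n
      · subst hk; simp [hβ]
      · simpa [hk] using ha k
    rcases lt_trichotomy ‖z‖ 1 with h | h | h
    · refine absurd ?_ (hne z h)
      rw [revPoly_popuc a hβ, eval_mul, hz0, mul_zero]
    · exact h
    · have hz1 : z ≠ 0 := norm_pos_iff.1 (zero_lt_one.trans h)
      refine absurd ?_ (hne (conj z)⁻¹ ?_)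
      · refine (eval_revPoly ?_ hz1).2 hz0
        rw [popuc_succ_eq_opuc]
        exact natDegree_opuc_le _ _
      · rw [norm_inv, RCLike.norm_conj]
        exact inv_lt_one_of_one_lt₀ h

lemma card_roots_popuc (a : ℕ → ℂ) (β : ℂ) (n : ℕ) : (popuc a β n).roots.card = n := by
  cases n with
  | zero => simp [popuc]
  | succ n =>
    rw [popuc_succ_eq_opuc, IsAlgClosed.card_roots_eq_natDegree, natDegree_opuc]

/-! ### Power sums of zeros from logarithmic derivatives -/

lemma revPoly_prod_X_sub_C (s : Multiset ℂ) :
    revPoly s.card (s.map fun z => X - C z).prod = (s.map fun z => 1 - C (conj z) * X).prod := by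
  induction s using Multiset.induction_on with
  | empty => simp [revPoly]
  | cons z s ih =>
    simp only [Multiset.map_cons, Multiset.prod_cons, Multiset.card_cons]
    rw [← ih, revPoly, revPoly, Polynomial.map_mul, add_comm, reflect_mul (F := 1) (G := s.card)]
    · congr 1
      simp only [Polynomial.map_sub, map_X, map_C, reflect_sub, reflect_C]
      congr 1
      · simp
      · simp
    · rw [Polynomial.map_sub, map_X, map_C]
      exact natDegree_X_sub_C_le _
    · refine natDegree_map_le.trans (le_of_eq ?_)
      rw [natDegree_multiset_prod_X_sub_C_eq_card]

/-- The power series at the origin of the ratio `Φ_n / Φ_n^*`. -/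
def schurSeries (a : ℕ → ℂ) : ℕ → PowerSeries ℂ
  | 0 => 1
  | n + 1 => (𝕏 * schurSeries a n - 𝕔 (conj (a n))) *
      (1 - 𝕔 (a n) * (𝕏 * schurSeries a n))⁻¹

/-- The power series of minus the logarithmic derivative of `Φ_{n+1}^* / Φ_n^*`. -/
def stepLogDeriv (a : ℕ → ℂ) (n : ℕ) : PowerSeries ℂ :=
  𝔡 (𝕔 (a n) * (𝕏 * schurSeries a n)) * (1 - 𝕔 (a n) * (𝕏 * schurSeries a n))⁻¹

lemma inv_one_sub_mul_cancel (c : ℂ) (f : PowerSeries ℂ) :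
    (1 - 𝕔 c * (𝕏 * f))⁻¹ * (1 - 𝕔 c * (𝕏 * f)) = 1 :=
  PowerSeries.inv_mul_cancel _ (by simp)

/-- Clearing the denominator leaves an implicit equation. The factor `X` before the quadratic term
lets it be solved coefficient by coefficient. -/
lemma schurSeries_succ (a : ℕ → ℂ) (n : ℕ) :
    schurSeries a (n + 1) = 𝕏 * schurSeries a n - 𝕔 (conj (a n)) +
      𝕏 * (𝕔 (a n) * (schurSeries a (n + 1) * schurSeries a n)) := by
  have h := inv_one_sub_mul_cancel (a n) (schurSeries a n)
  have h1 : schurSeries a (n + 1) * (1 - 𝕔 (a n) * (𝕏 * schurSeries a n)) =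
      𝕏 * schurSeries a n - 𝕔 (conj (a n)) := by
    rw [schurSeries, mul_assoc, h, mul_one]
  linear_combination h1

lemma stepLogDeriv_mul (a : ℕ → ℂ) (n : ℕ) :
    stepLogDeriv a n * (1 - 𝕔 (a n) * (𝕏 * schurSeries a n)) =
      𝔡 (𝕔 (a n) * (𝕏 * schurSeries a n)) := by
  rw [stepLogDeriv, mul_assoc, inv_one_sub_mul_cancel, mul_one]

lemma coe_opuc (a : ℕ → ℂ) (n : ℕ) :
    (opuc a n : PowerSeries ℂ) = schurSeries a n * (revPoly n (opuc a n) : ℂ[X]) := by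
  induction n with
  | zero => simp [opuc, revPoly, schurSeries]
  | succ n ih =>
    rw [revPoly_opuc_succ]
    conv_lhs => rw [opuc]
    push_cast
    rw [ih]
    linear_combination (-(revPoly n (opuc a n) : PowerSeries ℂ)) * schurSeries_succ a n

lemma coe_revPoly_opuc_succ (a : ℕ → ℂ) (n : ℕ) :
    (revPoly (n + 1) (opuc a (n + 1)) : PowerSeries ℂ) =
      (revPoly n (opuc a n) : ℂ[X]) * (1 - 𝕔 (a n) * (𝕏 * schurSeries a n)) := by
  rw [revPoly_opuc_succ]
  push_cast
  rw [coe_opuc]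
  ring

lemma derivative_coe_revPoly_opuc (a : ℕ → ℂ) (n : ℕ) :
    𝔡 (revPoly n (opuc a n) : PowerSeries ℂ) =
      -(∑ i ∈ Finset.range n, stepLogDeriv a i) * (revPoly n (opuc a n) : ℂ[X]) := by
  induction n with
  | zero => simp [opuc, revPoly]
  | succ n ih =>
    rw [coe_revPoly_opuc_succ, Derivation.leibniz, ih, map_sub, ← stepLogDeriv_mul,
      Finset.sum_range_succ]
    simp only [smul_eq_mul, Derivation.map_one_eq_zero]
    ring

lemma mk_pow_mul_one_sub (c : ℂ) :
    PowerSeries.mk (fun k => c ^ k) * (1 - 𝕔 c * 𝕏) = 1 := by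
  ext k
  rw [show PowerSeries.mk (fun k => c ^ k) * (1 - 𝕔 c * 𝕏) =
    PowerSeries.mk (fun k => c ^ k) - 𝕔 c * (PowerSeries.mk (fun k => c ^ k) * 𝕏) by ring]
  cases k with
  | zero => simp
  | succ k => simp [PowerSeries.coeff_succ_mul_X, PowerSeries.coeff_one, pow_succ']

/-- Newton's identities: each factor contributes `-z / (1 - z X)` to the logarithmic derivative, a
geometric series. -/
lemma derivative_prod_one_sub (s : Multiset ℂ) :
    𝔡 ((s.map fun z => 1 - 𝕔 z * 𝕏).prod) =
      -PowerSeries.mk (fun k => (s.map fun z => z ^ (k + 1)).sum) *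
        (s.map fun z => 1 - 𝕔 z * 𝕏).prod := by
  induction s using Multiset.induction_on with
  | empty =>
    simp only [Multiset.map_zero, Multiset.prod_zero, Multiset.sum_zero,
      Derivation.map_one_eq_zero]
    rw [show PowerSeries.mk (fun _ : ℕ => (0 : ℂ)) = 0 from rfl]
    simp
  | cons z s ih =>
    simp only [Multiset.map_cons, Multiset.prod_cons, Multiset.sum_cons]
    rw [show PowerSeries.mk (fun k => z ^ (k + 1) + (s.map fun z => z ^ (k + 1)).sum) =
      𝕔 z * PowerSeries.mk (fun k => z ^ k) +
        PowerSeries.mk (fun k => (s.map fun z => z ^ (k + 1)).sum) by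
      ext k; simp [pow_succ'], Derivation.leibniz, ih]
    simp only [smul_eq_mul, map_sub, Derivation.map_one_eq_zero, Derivation.leibniz,
      PowerSeries.derivative_C, PowerSeries.derivative_X]
    linear_combination 𝕔 z * (s.map fun z => 1 - 𝕔 z * 𝕏).prod * mk_pow_mul_one_sub z

/-- Power sums of the zeros as sums of coefficients of the logarithmic derivatives. -/
lemma sum_conj_pow_roots_opuc (a : ℕ → ℂ) (n k : ℕ) :
    ((opuc a n).roots.map fun z => conj z ^ (k + 1)).sum =
      ∑ i ∈ Finset.range n, PowerSeries.coeff k (stepLogDeriv a i) := by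
  set s := (opuc a n).roots with hs
  have hcard : s.card = n := by
    rw [hs, IsAlgClosed.card_roots_eq_natDegree, natDegree_opuc]
  have hprod : (s.map fun z => X - C z).prod = opuc a n :=
    prod_multiset_X_sub_C_of_monic_of_roots_card_eq (monic_opuc a n)
      (by rw [IsAlgClosed.card_roots_eq_natDegree])
  have hrev : (revPoly n (opuc a n) : PowerSeries ℂ) =
      ((s.map (starRingEnd ℂ)).map fun z => 1 - 𝕔 z * 𝕏).prod := by
    rw [← hprod]
    conv_lhs => rw [← hcard]
    rw [revPoly_prod_X_sub_C, ← coeToPowerSeries.ringHom_apply, map_multiset_prod,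
      Multiset.map_map, Multiset.map_map]
    congr 1
    refine Multiset.map_congr rfl fun z _ => ?_
    simp
  have hne : (revPoly n (opuc a n) : PowerSeries ℂ) ≠ 0 := by
    intro h
    have h1 := congrArg (PowerSeries.coeff 0) h
    rw [Polynomial.coeff_coe, coeff_revPoly_of_le _ (Nat.zero_le n)] at h1
    simp [coeff_opuc_self] at h1
  have h1 := derivative_coe_revPoly_opuc a n
  have h2 := derivative_prod_one_sub (s.map (starRingEnd ℂ))
  rw [← hrev, h1] at h2
  have h3 := neg_injective (mul_right_cancel₀ hne h2)
  have h4 := congrArg (PowerSeries.coeff k) h3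
  rw [map_sum, PowerSeries.coeff_mk, Multiset.map_map] at h4
  exact h4.symm

/-! ### Coefficient recursions and uniform bounds -/

lemma coeff_zero_schurSeries_succ (a : ℕ → ℂ) (n : ℕ) :
    PowerSeries.coeff 0 (schurSeries a (n + 1)) = -conj (a n) := by
  rw [schurSeries_succ]; simp

lemma coeff_succ_schurSeries_succ (a : ℕ → ℂ) (n k : ℕ) :
    PowerSeries.coeff (k + 1) (schurSeries a (n + 1)) = PowerSeries.coeff k (schurSeries a n) +
      a n * ∑ p ∈ Finset.HasAntidiagonal.antidiagonal k,
        PowerSeries.coeff p.1 (schurSeries a (n + 1)) * PowerSeries.coeff p.2 (schurSeries a n) := by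
  conv_lhs => rw [schurSeries_succ]
  rw [map_add, map_sub, PowerSeries.coeff_succ_X_mul, PowerSeries.coeff_succ_X_mul,
    PowerSeries.coeff_C_mul, PowerSeries.coeff_mul]
  simp

/-- Stated for abstract `f`, `h` so that it serves both the step series and their limits. -/
lemma coeff_of_mul_one_sub_eq_derivative {c : ℂ} {f h : PowerSeries ℂ}
    (H : h * (1 - 𝕔 c * (𝕏 * f)) = 𝔡 (𝕔 c * (𝕏 * f))) (k : ℕ) :
    PowerSeries.coeff k h = c * PowerSeries.coeff k f * (k + 1) +
      PowerSeries.coeff k (𝕏 * (𝕔 c * (f * h))) := by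
  have h1 : h = 𝔡 (𝕔 c * (𝕏 * f)) + 𝕏 * (𝕔 c * (f * h)) := by linear_combination H
  conv_lhs => rw [h1]
  rw [map_add, PowerSeries.coeff_derivative, PowerSeries.coeff_C_mul,
    PowerSeries.coeff_succ_X_mul]

lemma coeff_zero_of_mul_one_sub_eq_derivative {c : ℂ} {f h : PowerSeries ℂ}
    (H : h * (1 - 𝕔 c * (𝕏 * f)) = 𝔡 (𝕔 c * (𝕏 * f))) :
    PowerSeries.coeff 0 h = c * PowerSeries.coeff 0 f := by
  rw [coeff_of_mul_one_sub_eq_derivative H]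
  simp

lemma coeff_succ_of_mul_one_sub_eq_derivative {c : ℂ} {f h : PowerSeries ℂ}
    (H : h * (1 - 𝕔 c * (𝕏 * f)) = 𝔡 (𝕔 c * (𝕏 * f))) (k : ℕ) :
    PowerSeries.coeff (k + 1) h = c * PowerSeries.coeff (k + 1) f * (k + 2) +
      c * ∑ p ∈ Finset.HasAntidiagonal.antidiagonal k,
        PowerSeries.coeff p.1 f * PowerSeries.coeff p.2 h := by
  rw [coeff_of_mul_one_sub_eq_derivative H, PowerSeries.coeff_succ_X_mul,
    PowerSeries.coeff_C_mul, PowerSeries.coeff_mul]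
  push_cast
  ring

lemma norm_sum_antidiagonal_mul_le {k : ℕ} {u v : ℕ → ℂ} {U V : ℕ → ℝ}
    (hu : ∀ m ≤ k, ‖u m‖ ≤ U m) (hv : ∀ m ≤ k, ‖v m‖ ≤ V m) :
    ‖∑ p ∈ Finset.HasAntidiagonal.antidiagonal k, u p.1 * v p.2‖ ≤
      ∑ p ∈ Finset.HasAntidiagonal.antidiagonal k, U p.1 * V p.2 := by
  refine norm_sum_le_of_le _ fun p hp => ?_
  have hp' := Finset.HasAntidiagonal.mem_antidiagonal.1 hp
  rw [norm_mul]
  exact mul_le_mul (hu _ (by omega)) (hv _ (by omega)) (norm_nonneg _)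
    ((norm_nonneg _).trans (hu _ (by omega)))

/-- The Taylor coefficients of the ratios `Φ_n / Φ_n^*` are bounded uniformly in the Verblunsky
coefficients. -/
lemma exists_bound_coeff_schurSeries :
    ∃ B : ℕ → ℝ, ∀ k (a : ℕ → ℂ), (∀ n, ‖a n‖ ≤ 1) → ∀ n,
      ‖PowerSeries.coeff k (schurSeries a n)‖ ≤ B k := by
  suffices H : ∀ k, ∃ B : ℝ, ∀ a : ℕ → ℂ, (∀ n, ‖a n‖ ≤ 1) → ∀ n,
      ‖PowerSeries.coeff k (schurSeries a n)‖ ≤ B by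
    choose B hB using H
    exact ⟨B, hB⟩
  intro k
  induction k using Nat.strong_induction_on with
  | _ k ih =>
  cases k with
  | zero =>
    refine ⟨1, fun a ha n => ?_⟩
    cases n with
    | zero => simp [schurSeries]
    | succ n => simpa [coeff_zero_schurSeries_succ] using ha n
  | succ k =>
    -- The dummy bound `0` beyond `k` lets `choose` produce a function on all of `ℕ`.
    have ih' : ∀ m, ∃ B : ℝ, m ≤ k → ∀ a : ℕ → ℂ, (∀ n, ‖a n‖ ≤ 1) → ∀ n,
        ‖PowerSeries.coeff m (schurSeries a n)‖ ≤ B := by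
      intro m
      by_cases hm : m ≤ k
      · obtain ⟨B, hB⟩ := ih m (Nat.lt_succ_of_le hm)
        exact ⟨B, fun _ => hB⟩
      · exact ⟨0, fun h => absurd h hm⟩
    choose B hB using ih'
    refine ⟨B k + ∑ p ∈ Finset.HasAntidiagonal.antidiagonal k, B p.1 * B p.2, fun a ha n => ?_⟩
    have hk : ∀ n, ‖PowerSeries.coeff k (schurSeries a n)‖ ≤ B k := hB k le_rfl a ha
    have hs : ∀ n m, ‖∑ p ∈ Finset.HasAntidiagonal.antidiagonal k,
        PowerSeries.coeff p.1 (schurSeries a n) * PowerSeries.coeff p.2 (schurSeries a m)‖ ≤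
        ∑ p ∈ Finset.HasAntidiagonal.antidiagonal k, B p.1 * B p.2 := fun n m =>
      norm_sum_antidiagonal_mul_le (u := fun i => PowerSeries.coeff i (schurSeries a n))
        (v := fun i => PowerSeries.coeff i (schurSeries a m))
        (fun i hi => hB i hi a ha n) (fun i hi => hB i hi a ha m)
    cases n with
    | zero =>
      have h1 := (norm_nonneg _).trans (hk 0)
      have h2 := (norm_nonneg _).trans (hs 0 0)
      simpa [schurSeries, PowerSeries.coeff_one] using add_nonneg h1 h2
    | succ n =>
      rw [coeff_succ_schurSeries_succ]
      refine (norm_add_le _ _).trans (add_le_add (hk n) ?_)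
      rw [norm_mul]
      exact (mul_le_of_le_one_left (norm_nonneg _) (ha n)).trans (hs _ _)

/-- Coefficients of modulus one are admitted so that the bound also covers the sequence with `β`
inserted. -/
lemma exists_bound_coeff_stepLogDeriv :
    ∃ B : ℕ → ℝ, ∀ k (a : ℕ → ℂ), (∀ n, ‖a n‖ ≤ 1) → ∀ n,
      ‖PowerSeries.coeff k (stepLogDeriv a n)‖ ≤ B k := by
  obtain ⟨D, hD⟩ := exists_bound_coeff_schurSeries
  suffices H : ∀ k, ∃ B : ℝ, ∀ a : ℕ → ℂ, (∀ n, ‖a n‖ ≤ 1) → ∀ n,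
      ‖PowerSeries.coeff k (stepLogDeriv a n)‖ ≤ B by
    choose B hB using H
    exact ⟨B, hB⟩
  intro k
  induction k using Nat.strong_induction_on with
  | _ k ih =>
  cases k with
  | zero =>
    refine ⟨D 0, fun a ha n => ?_⟩
    rw [coeff_zero_of_mul_one_sub_eq_derivative (stepLogDeriv_mul a n), norm_mul]
    exact (mul_le_of_le_one_left (norm_nonneg _) (ha n)).trans (hD 0 a ha n)
  | succ k =>
    have ih' : ∀ m, ∃ B : ℝ, m ≤ k → ∀ a : ℕ → ℂ, (∀ n, ‖a n‖ ≤ 1) → ∀ n,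
        ‖PowerSeries.coeff m (stepLogDeriv a n)‖ ≤ B := by
      intro m
      by_cases hm : m ≤ k
      · obtain ⟨B, hB⟩ := ih m (Nat.lt_succ_of_le hm)
        exact ⟨B, fun _ => hB⟩
      · exact ⟨0, fun h => absurd h hm⟩
    choose B hB using ih'
    refine ⟨D (k + 1) * (k + 2) +
      ∑ p ∈ Finset.HasAntidiagonal.antidiagonal k, D p.1 * B p.2, fun a ha n => ?_⟩
    rw [coeff_succ_of_mul_one_sub_eq_derivative (stepLogDeriv_mul a n)]
    refine (norm_add_le _ _).trans (add_le_add ?_ ?_)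
    · rw [norm_mul, norm_mul, show (k + 2 : ℂ) = ((k + 2 : ℕ) : ℂ) by push_cast; rfl,
        Complex.norm_natCast]
      push_cast
      refine mul_le_mul_of_nonneg_right ?_ (by positivity)
      exact (mul_le_of_le_one_left (norm_nonneg _) (ha n)).trans (hD _ a ha n)
    · rw [norm_mul]
      exact (mul_le_of_le_one_left (norm_nonneg _) (ha n)).trans
        (norm_sum_antidiagonal_mul_le (u := fun i => PowerSeries.coeff i (schurSeries a n))
          (v := fun i => PowerSeries.coeff i (stepLogDeriv a n))
          (fun i _ => hD i a ha n) (fun i hi => hB i hi a ha n))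

/-! ### Ratio limits of the coefficients -/

lemma RatioTendsto.succ {E : Type*} [TopologicalSpace E] {x : ℕ → ℕ → E} {s : ℝ} {L : E}
    (h : RatioTendsto x s L) : RatioTendsto (fun n N => x (n + 1) N) s L := by
  intro n N hn hN hnN
  refine h (fun j => n j + 1) N ((tendsto_add_atTop_nat 1).comp hn) hN ?_
  have h1 : Tendsto (fun j => (n j : ℝ) / N j + 1 / (N j : ℝ)) atTop (𝓝 (s + 0)) :=
    hnN.add ((tendsto_const_div_atTop_nhds_zero_nat 1).comp hN)
  rw [add_zero] at h1
  refine h1.congr fun j => ?_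
  push_cast
  ring

/-- A unit shift changes `n/N` by `1/N → 0`, so recursions giving the term at `n + 1` determine the
limit at `n`. -/
lemma RatioTendsto.of_succ {E : Type*} [TopologicalSpace E] {x : ℕ → ℕ → E} {s : ℝ} {L : E}
    (h : RatioTendsto (fun n N => x (n + 1) N) s L) : RatioTendsto x s L := by
  intro n N hn hN hnN
  have hev : ∀ᶠ j in atTop, 1 ≤ n j := hn.eventually_ge_atTop 1
  have h1 : Tendsto (fun j => (n j : ℝ) / N j - 1 / (N j : ℝ)) atTop (𝓝 (s - 0)) :=
    hnN.sub ((tendsto_const_div_atTop_nhds_zero_nat 1).comp hN)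
  rw [sub_zero] at h1
  refine (h (fun j => n j - 1) N ((tendsto_sub_atTop_nat 1).comp hn) hN ?_).congr' ?_
  · refine h1.congr' ?_
    filter_upwards [hev] with j hj
    rw [Nat.cast_sub hj]
    push_cast
    ring
  · filter_upwards [hev] with j hj
    simp only [Nat.sub_add_cancel hj]

lemma RatioTendsto.sum_antidiagonal_mul {x y : ℕ → ℕ → PowerSeries ℂ} {s : ℝ}
    {u v : PowerSeries ℂ} {k : ℕ}
    (hx : ∀ m ≤ k, RatioTendsto (fun n N => PowerSeries.coeff m (x n N)) s (PowerSeries.coeff m u))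
    (hy : ∀ m ≤ k, RatioTendsto (fun n N => PowerSeries.coeff m (y n N)) s
      (PowerSeries.coeff m v)) :
    RatioTendsto (fun n N => ∑ p ∈ Finset.HasAntidiagonal.antidiagonal k,
      PowerSeries.coeff p.1 (x n N) * PowerSeries.coeff p.2 (y n N)) s
      (∑ p ∈ Finset.HasAntidiagonal.antidiagonal k,
        PowerSeries.coeff p.1 u * PowerSeries.coeff p.2 v) := by
  intro n N hn hN hnN
  refine tendsto_finsetSum _ fun p hp => ?_
  have hp' := Finset.HasAntidiagonal.mem_antidiagonal.1 hp
  exact (hx p.1 (by omega) n N hn hN hnN).mul (hy p.2 (by omega) n N hn hN hnN)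

/-- If the Verblunsky coefficients converge to `c`, the Taylor coefficients of `Φ_n / Φ_n^*`
converge to those of the fixed point `f` of the Schur step with parameter `c`. -/
lemma ratioTendsto_coeff_schurSeries {A : ℕ → ℕ → ℂ} {s : ℝ} {c : ℂ} (hA : RatioTendsto A s c)
    {f : PowerSeries ℂ} (hf : f = 𝕏 * f - 𝕔 (conj c) + 𝕏 * (𝕔 c * (f * f))) (k : ℕ) :
    RatioTendsto (fun n N => PowerSeries.coeff k (schurSeries (fun i => A i N) n)) s
      (PowerSeries.coeff k f) := by
  induction k using Nat.strong_induction_on with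
  | _ k ih =>
  refine RatioTendsto.of_succ ?_
  cases k with
  | zero =>
    rw [hf]
    intro n N hn hN hnN
    simp only [coeff_zero_schurSeries_succ]
    simpa using ((Complex.continuous_conj.tendsto c).comp (hA n N hn hN hnN)).neg
  | succ k =>
    have hfk : PowerSeries.coeff (k + 1) f = PowerSeries.coeff k f +
        c * ∑ p ∈ Finset.HasAntidiagonal.antidiagonal k,
          PowerSeries.coeff p.1 f * PowerSeries.coeff p.2 f := by
      conv_lhs => rw [hf]
      rw [map_add, map_sub, PowerSeries.coeff_succ_X_mul, PowerSeries.coeff_succ_X_mul,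
        PowerSeries.coeff_C_mul, PowerSeries.coeff_mul]
      simp
    rw [hfk]
    simp only [coeff_succ_schurSeries_succ]
    have hsum := RatioTendsto.sum_antidiagonal_mul
      (x := fun n N => schurSeries (fun i => A i N) (n + 1))
      (y := fun n N => schurSeries (fun i => A i N) n) (k := k)
      (fun m hm => (ih m (Nat.lt_succ_of_le hm)).succ) fun m hm => ih m (Nat.lt_succ_of_le hm)
    intro n N hn hN hnN
    exact (ih k k.lt_succ_self n N hn hN hnN).add
      ((hA n N hn hN hnN).mul (hsum n N hn hN hnN))

lemma ratioTendsto_coeff_stepLogDeriv {A : ℕ → ℕ → ℂ} {s : ℝ} {c : ℂ} (hA : RatioTendsto A s c)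
    {f h : PowerSeries ℂ} (hf : f = 𝕏 * f - 𝕔 (conj c) + 𝕏 * (𝕔 c * (f * f)))
    (hh : h * (1 - 𝕔 c * (𝕏 * f)) = 𝔡 (𝕔 c * (𝕏 * f))) (k : ℕ) :
    RatioTendsto (fun n N => PowerSeries.coeff k (stepLogDeriv (fun i => A i N) n)) s
      (PowerSeries.coeff k h) := by
  have hF := ratioTendsto_coeff_schurSeries hA hf
  induction k using Nat.strong_induction_on with
  | _ k ih =>
  cases k with
  | zero =>
    rw [coeff_zero_of_mul_one_sub_eq_derivative hh]
    intro n N hn hN hnN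
    simp only [coeff_zero_of_mul_one_sub_eq_derivative (stepLogDeriv_mul _ _)]
    exact (hA n N hn hN hnN).mul (hF 0 n N hn hN hnN)
  | succ k =>
    rw [coeff_succ_of_mul_one_sub_eq_derivative hh]
    simp only [coeff_succ_of_mul_one_sub_eq_derivative (stepLogDeriv_mul _ _)]
    have hsum := RatioTendsto.sum_antidiagonal_mul
      (x := fun n N => schurSeries (fun i => A i N) n)
      (y := fun n N => stepLogDeriv (fun i => A i N) n) (k := k)
      (fun m _ => hF m) fun m hm => ih m (Nat.lt_succ_of_le hm)
    intro n N hn hN hnN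
    exact (((hA n N hn hN hnN).mul (hF (k + 1) n N hn hN hnN)).mul_const _).add
      ((hA n N hn hN hnN).mul (hsum n N hn hN hnN))

/-! ### Averages as integrals -/

lemma sum_range_eq_integral_floor (x : ℕ → ℂ) (n : ℕ) :
    ∑ i ∈ Finset.range n, x i = ∫ v in (0 : ℝ)..n, x ⌊v⌋₊ := by
  have hcongr : ∀ i : ℕ, Set.EqOn (fun _ : ℝ => x i) (fun v : ℝ => x ⌊v⌋₊)
      (Set.Ioo (i : ℝ) ((i + 1 : ℕ) : ℝ)) := by
    intro i v hv
    have : ⌊v⌋₊ = i := by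
      rw [Nat.floor_eq_iff (i.cast_nonneg.trans hv.1.le)]
      exact ⟨hv.1.le, by simpa using hv.2⟩
    simp only [this]
  have hle : ∀ i : ℕ, (i : ℝ) ≤ ((i + 1 : ℕ) : ℝ) := fun i => by push_cast; linarith
  have hint : ∀ i : ℕ, ∫ v in (i : ℝ)..((i + 1 : ℕ) : ℝ), x ⌊v⌋₊ = x i := by
    intro i
    rw [intervalIntegral.integral_of_le (hle i), integral_Ioc_eq_integral_Ioo,
      ← setIntegral_congr_fun measurableSet_Ioo (hcongr i)]
    simp
  have hii : ∀ i : ℕ, IntervalIntegrable (fun v : ℝ => x ⌊v⌋₊) volume (i : ℝ)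
      ((i + 1 : ℕ) : ℝ) := by
    intro i
    rw [intervalIntegrable_iff_integrableOn_Ioo_of_le (hle i)]
    exact (integrableOn_const (C := x i) (by simp)).congr_fun (hcongr i) measurableSet_Ioo
  have h := intervalIntegral.sum_integral_adjacent_intervals (μ := volume)
    (f := fun v : ℝ => x ⌊v⌋₊) (a := fun i : ℕ => (i : ℝ)) (n := n) fun i _ => hii i
  simp only [hint, Nat.cast_zero] at h
  exact h

/-- Rescaling puts all averages on the fixed interval `[0, t]`, ready for dominated convergence. -/
lemma average_eq_integral_floor (x : ℕ → ℂ) {n : ℕ} (hn : n ≠ 0) {t : ℝ} (ht : 0 < t) :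
    (n : ℂ)⁻¹ * ∑ i ∈ Finset.range n, x i =
      (t : ℂ)⁻¹ * ∫ y in (0 : ℝ)..t, x ⌊(n / t) * y⌋₊ := by
  have hn' : (n : ℝ) ≠ 0 := Nat.cast_ne_zero.2 hn
  have h := intervalIntegral.integral_comp_mul_left (a := 0) (b := t) (fun v : ℝ => x ⌊v⌋₊)
    (div_ne_zero hn' ht.ne')
  rw [h, mul_zero, div_mul_cancel₀ _ ht.ne', ← sum_range_eq_integral_floor, Complex.real_smul]
  push_cast
  have : (t : ℂ) ≠ 0 := by exact_mod_cast ht.ne'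
  have : (n : ℂ) ≠ 0 := by exact_mod_cast hn
  field_simp

/-- Averages of a bounded family converging in the ratio sense for almost every ratio. -/
lemma ratioTendsto_average {x : ℕ → ℕ → ℂ} {B : ℝ} (hx : ∀ n N, ‖x n N‖ ≤ B) {t : ℝ}
    (ht : 0 < t) {L : ℝ → ℂ}
    (hL : ∀ᵐ s ∂(volume.restrict (Set.Icc 0 t)), RatioTendsto x s (L s)) :
    RatioTendsto (fun n N => (n : ℂ)⁻¹ * ∑ i ∈ Finset.range n, x i N) t
      ((t : ℂ)⁻¹ * ∫ s in Set.Icc 0 t, L s) := by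
  intro n N hn hN hnN
  have hev : ∀ᶠ j in atTop, n j ≠ 0 := by
    filter_upwards [hn.eventually_ge_atTop 1] with j hj using by omega
  have hmain : Tendsto (fun j => ∫ y in Set.Icc 0 t, x ⌊((n j : ℝ) / t) * y⌋₊ (N j)) atTop
      (𝓝 (∫ s in Set.Icc 0 t, L s)) := by
    refine tendsto_integral_of_dominated_convergence (fun _ => B) (fun j => ?_) ?_
      (fun j => ae_of_all _ fun y => hx _ _) ?_
    · have : Measurable fun y : ℝ => x ⌊((n j : ℝ) / t) * y⌋₊ (N j) :=
        (measurable_of_countable fun m : ℕ => x m (N j)).comp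
          (Nat.measurable_floor.comp (measurable_const.mul measurable_id))
      exact this.aestronglyMeasurable
    · exact integrable_const B
    · have h0 : ∀ᵐ s : ℝ ∂(volume.restrict (Set.Icc 0 t)), s ≠ 0 :=
        ae_restrict_of_ae (by simp [ae_iff])
      filter_upwards [hL, h0, ae_restrict_mem measurableSet_Icc] with s hs hs0 hst
      have hspos : 0 < s := lt_of_le_of_ne hst.1 (Ne.symm hs0)
      have hc : 0 < s / t := div_pos hspos ht
      have hy : Tendsto (fun j => ((n j : ℝ) / t) * s) atTop atTop := by
        have := (tendsto_natCast_atTop_atTop (R := ℝ)).comp hn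
        refine (this.atTop_mul_const hc).congr fun j => ?_
        simp only [Function.comp]
        ring
      refine hs _ _ (tendsto_nat_floor_atTop.comp hy) hN ?_
      -- The floor is asymptotic to `n s / t`, so its ratio to `N` tends to `t * (s / t) = s`.
      have h1 : Tendsto (fun j => ((⌊((n j : ℝ) / t) * s⌋₊ : ℝ) / (((n j : ℝ) / t) * s)) *
          (((n j : ℝ) / N j) * (s / t))) atTop (𝓝 (1 * (t * (s / t)))) :=
        (tendsto_nat_floor_div_atTop.comp hy).mul (hnN.mul_const _)
      rw [one_mul, mul_div_cancel₀ _ ht.ne'] at h1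
      refine h1.congr' ?_
      filter_upwards [hev] with j hj
      have : (n j : ℝ) ≠ 0 := Nat.cast_ne_zero.2 hj
      rcases eq_or_ne (N j : ℝ) 0 with h | h
      · simp [h]
      · have := ht.ne'
        field_simp
  refine (hmain.const_mul _).congr' ?_
  filter_upwards [hev] with j hj
  rw [average_eq_integral_floor (fun i => x i (N j)) hj ht, intervalIntegral.integral_of_le ht.le,
    integral_Icc_eq_integral_Ioc]

/-! ### Central binomial series and the Poisson kernel -/

/-- The generating function `(1 - 4 q X) ^ (-1/2)` of the central binomial coefficients. -/
def centralBinomSeries (q : ℂ) : PowerSeries ℂ :=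
  PowerSeries.mk fun m => (m.centralBinom : ℂ) * q ^ m

lemma derivative_centralBinomSeries (q : ℂ) :
    𝔡 (centralBinomSeries q) * (1 - 𝕔 (4 * q) * 𝕏) = 𝕔 (2 * q) * centralBinomSeries q := by
  have hrec : ∀ k : ℕ, (((k + 1).centralBinom : ℕ) : ℂ) * (k + 1) =
      2 * (2 * k + 1) * (k.centralBinom : ℂ) := by
    intro k
    have := Nat.succ_mul_centralBinom_succ k
    rw [mul_comm]
    exact_mod_cast this
  rw [mul_sub, mul_one, show 𝔡 (centralBinomSeries q) * (𝕔 (4 * q) * 𝕏) =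
    𝕔 (4 * q) * (𝔡 (centralBinomSeries q) * 𝕏) by ring]
  ext k
  rw [map_sub, PowerSeries.coeff_C_mul, PowerSeries.coeff_C_mul, PowerSeries.coeff_derivative]
  cases k with
  | zero =>
    have := hrec 0
    simp only [PowerSeries.coeff_zero_mul_X, centralBinomSeries, PowerSeries.coeff_mk]
    simp only [CharP.cast_eq_zero, zero_add] at this ⊢
    simp only [Nat.centralBinom_zero] at this ⊢
    linear_combination q * this
  | succ k =>
    rw [PowerSeries.coeff_succ_mul_X, PowerSeries.coeff_derivative]
    simp only [centralBinomSeries, PowerSeries.coeff_mk]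
    have h1 := hrec (k + 1)
    push_cast at h1 ⊢
    linear_combination q ^ (k + 1 + 1) * h1

/-- The differential equation above makes the derivative of the left side vanish; the constant terms
agree. -/
lemma centralBinomSeries_sq_mul (q : ℂ) :
    centralBinomSeries q ^ 2 * (1 - 𝕔 (4 * q) * 𝕏) = 1 := by
  refine PowerSeries.derivative.ext ?_ ?_
  · have h := derivative_centralBinomSeries q
    rw [Derivation.leibniz, Derivation.leibniz_pow, map_sub, Derivation.leibniz]
    simp only [smul_eq_mul, Derivation.map_one_eq_zero, PowerSeries.derivative_C,
      PowerSeries.derivative_X, nsmul_eq_mul]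
    have h4 : 𝕔 (4 * q) = 2 * 𝕔 (2 * q) := by
      rw [show (4 * q) = 2 * (2 * q) by ring, map_mul 𝕔 2 (2 * q), map_ofNat]
    rw [h4] at h ⊢
    push_cast
    linear_combination 2 * centralBinomSeries q * h
  · simp [centralBinomSeries]

/-- The series `X / (1 + X) ^ 2`. -/
def koebeSeries : PowerSeries ℂ := 𝕏 * (1 + 𝕏)⁻¹ ^ 2

lemma one_add_X_mul_inv : (1 + 𝕏) * (1 + 𝕏)⁻¹ = 1 :=
  PowerSeries.mul_inv_cancel _ (by simp)

lemma koebeSeries_mul : koebeSeries * (1 + 𝕏) ^ 2 = 𝕏 := by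
  have h := one_add_X_mul_inv
  rw [koebeSeries, mul_assoc, ← mul_pow, mul_comm _ (1 + 𝕏), h, one_pow, mul_one]

lemma hasSubst_koebeSeries : PowerSeries.HasSubst koebeSeries :=
  PowerSeries.HasSubst.of_constantCoeff_zero' (by simp [koebeSeries])

/-- The series `(1 - X) / (1 + X) * F (X / (1 + X) ^ 2)`. -/
def koebeTransform (F : PowerSeries ℂ) : PowerSeries ℂ :=
  (1 - 𝕏) * (1 + 𝕏)⁻¹ * F.subst koebeSeries

lemma coeff_subst_koebeSeries (F : PowerSeries ℂ) {q k : ℕ} (hq : q ≤ k) :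
    PowerSeries.coeff q (F.subst koebeSeries) =
      ∑ m ∈ Finset.range (k + 1),
        PowerSeries.coeff m F * PowerSeries.coeff q (koebeSeries ^ m) := by
  rw [PowerSeries.coeff_subst' hasSubst_koebeSeries]
  refine finsum_eq_sum_of_support_subset _ fun m hm => ?_
  rw [Finset.coe_range, Set.mem_Iio]
  by_contra hmk
  refine hm ?_
  have hdvd : 𝕏 ^ m ∣ koebeSeries ^ m := pow_dvd_pow_of_dvd (Dvd.intro _ rfl) m
  simp only [PowerSeries.X_pow_dvd_iff.1 hdvd q (by omega), smul_zero]

/-- The sum is finite since `X ^ m` divides `koebeSeries ^ m`. Its weights do not depend on `F`, so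
integration in a parameter of `F` passes through. -/
lemma coeff_koebeTransform (F : PowerSeries ℂ) (k : ℕ) :
    PowerSeries.coeff k (koebeTransform F) =
      ∑ m ∈ Finset.range (k + 1), PowerSeries.coeff m F *
        PowerSeries.coeff k ((1 - 𝕏) * (1 + 𝕏)⁻¹ * koebeSeries ^ m) := by
  rw [koebeTransform, PowerSeries.coeff_mul]
  simp only [PowerSeries.coeff_mul, Finset.mul_sum]
  rw [Finset.sum_comm]
  refine Finset.sum_congr rfl fun p hp => ?_
  have hp' := Finset.HasAntidiagonal.mem_antidiagonal.1 hp
  rw [coeff_subst_koebeSeries F (show p.2 ≤ k by omega), Finset.mul_sum]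
  exact Finset.sum_congr rfl fun m _ => by ring

lemma subst_koebeSeries_C (c : ℂ) : (𝕔 c).subst koebeSeries = 𝕔 c :=
  PowerSeries.subst_C c

lemma subst_koebeSeries_one_sub (c : ℂ) :
    (1 - 𝕔 c * 𝕏).subst koebeSeries = 1 - 𝕔 c * koebeSeries := by
  have h := hasSubst_koebeSeries
  rw [PowerSeries.subst_sub h, PowerSeries.subst_mul h, subst_koebeSeries_C,
    PowerSeries.subst_X h, ← map_one 𝕔, subst_koebeSeries_C]

lemma koebeTransform_centralBinomSeries (q : ℂ) :
    koebeTransform (centralBinomSeries q) ^ 2 * ((1 + 𝕏) ^ 2 - 𝕔 (4 * q) * 𝕏) =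
      (1 - 𝕏) ^ 2 := by
  have hs := hasSubst_koebeSeries
  have h := congrArg (PowerSeries.subst koebeSeries) (centralBinomSeries_sq_mul q)
  rw [PowerSeries.subst_mul hs, PowerSeries.subst_pow hs, subst_koebeSeries_one_sub,
    ← map_one 𝕔, subst_koebeSeries_C, map_one] at h
  have h1 := one_add_X_mul_inv
  rw [koebeTransform]
  set I := (1 + 𝕏)⁻¹
  set S := (centralBinomSeries q).subst koebeSeries
  have h2 : (1 + 𝕏) ^ 2 - 𝕔 (4 * q) * 𝕏 = (1 + 𝕏) ^ 2 * (1 - 𝕔 (4 * q) * koebeSeries) := by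
    linear_combination 𝕔 (4 * q) * koebeSeries_mul
  rw [h2]
  calc _ = (1 - 𝕏) ^ 2 * ((1 + 𝕏) * I) ^ 2 * (S ^ 2 * (1 - 𝕔 (4 * q) * koebeSeries)) := by ring
    _ = _ := by rw [h, h1]; ring

lemma koebeTransform_mk_pow (s : ℂ) :
    koebeTransform (PowerSeries.mk fun m => s ^ m) * ((1 + 𝕏) ^ 2 - 𝕔 s * 𝕏) =
      (1 - 𝕏) * (1 + 𝕏) := by
  have hs := hasSubst_koebeSeries
  have h := congrArg (PowerSeries.subst koebeSeries) (mk_pow_mul_one_sub s)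
  rw [PowerSeries.subst_mul hs, subst_koebeSeries_one_sub,
    ← map_one 𝕔, subst_koebeSeries_C, map_one] at h
  have h1 := one_add_X_mul_inv
  rw [koebeTransform]
  set I := (1 + 𝕏)⁻¹
  set S := (PowerSeries.mk fun m => s ^ m).subst koebeSeries
  have h2 : (1 + 𝕏) ^ 2 - 𝕔 s * 𝕏 = (1 + 𝕏) ^ 2 * (1 - 𝕔 s * koebeSeries) := by
    linear_combination 𝕔 s * koebeSeries_mul
  rw [h2]
  calc _ = (1 - 𝕏) * (1 + 𝕏) * ((1 + 𝕏) * I) * (S * (1 - 𝕔 s * koebeSeries)) := by ring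
    _ = _ := by rw [h, h1]; ring

/-- The expansion of the Poisson kernel. -/
lemma pow_add_pow_eq_sum {w v : ℂ} (hwv : w * v = 1) (k : ℕ) :
    w ^ (k + 1) + v ^ (k + 1) = ∑ m ∈ Finset.range (k + 2), (2 + w + v) ^ m *
        PowerSeries.coeff (k + 1) ((1 - 𝕏) * (1 + 𝕏)⁻¹ * koebeSeries ^ m) := by
  have h := koebeTransform_mk_pow (2 + w + v)
  have hfac : (1 + 𝕏) ^ 2 - 𝕔 (2 + w + v) * 𝕏 = (1 - 𝕔 w * 𝕏) * (1 - 𝕔 v * 𝕏) := by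
    have h1 : 𝕔 w * 𝕔 v = 1 := by rw [← map_mul, hwv, map_one]
    rw [map_add, map_add, show 𝕔 2 = 2 from map_ofNat 𝕔 2]
    linear_combination -𝕏 ^ 2 * h1
  have hne : (1 + 𝕏) ^ 2 - 𝕔 (2 + w + v) * 𝕏 ≠ 0 := by
    intro h0
    simpa using congrArg (PowerSeries.coeff 0) h0
  -- The Poisson kernel: `1/(1-wX) + 1/(1-vX) - 1 = (1-X^2) / ((1-wX)(1-vX))` when `w v = 1`.
  have hK : koebeTransform (PowerSeries.mk fun m => (2 + w + v) ^ m) =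
      PowerSeries.mk (fun k => w ^ k) + PowerSeries.mk (fun k => v ^ k) - 1 := by
    refine mul_right_cancel₀ hne ?_
    rw [h, hfac]
    have h1 : 𝕔 w * 𝕔 v = 1 := by rw [← map_mul, hwv, map_one]
    linear_combination -(1 - 𝕔 v * 𝕏) * mk_pow_mul_one_sub w -
      (1 - 𝕔 w * 𝕏) * mk_pow_mul_one_sub v + 𝕏 ^ 2 * h1
  have h2 := coeff_koebeTransform (PowerSeries.mk fun m => (2 + w + v) ^ m) (k + 1)
  rw [hK] at h2
  simpa [PowerSeries.coeff_one] using h2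

lemma eq_of_sq_eq_sq_of_coeff_zero {F G : PowerSeries ℂ} (h : F ^ 2 = G ^ 2)
    (hF : PowerSeries.coeff 0 F = 1) (hG : PowerSeries.coeff 0 G = 1) : F = G := by
  rcases sq_eq_sq_iff_eq_or_eq_neg.1 h with h | h
  · exact h
  · have h1 := congrArg (PowerSeries.coeff 0) h
    rw [map_neg, hF, hG] at h1
    norm_num at h1

lemma coeff_zero_koebeTransform_centralBinomSeries (q : ℂ) :
    PowerSeries.coeff 0 (koebeTransform (centralBinomSeries q)) = 1 := by
  rw [coeff_koebeTransform]
  simp [centralBinomSeries]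

lemma exists_sqrt_series (q : ℂ) : ∃ R : PowerSeries ℂ,
    R ^ 2 = (1 + 𝕏) ^ 2 - 𝕔 (4 * q) * 𝕏 ∧ PowerSeries.coeff 0 R = 1 ∧
      koebeTransform (centralBinomSeries q) * R = 1 - 𝕏 := by
  have hG := koebeTransform_centralBinomSeries q
  have hG0 := coeff_zero_koebeTransform_centralBinomSeries q
  set G := koebeTransform (centralBinomSeries q)
  have hG0' : PowerSeries.constantCoeff G = 1 := by simpa using hG0
  have hinv : G * G⁻¹ = 1 := PowerSeries.mul_inv_cancel _ (by rw [hG0']; exact one_ne_zero)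
  refine ⟨(1 - 𝕏) * G⁻¹, ?_, by simp [hG0'], by linear_combination (1 - 𝕏) * hinv⟩
  calc ((1 - 𝕏) * G⁻¹) ^ 2 = (1 - 𝕏) ^ 2 * G⁻¹ ^ 2 := by ring
    _ = ((1 + 𝕏) ^ 2 - 𝕔 (4 * q) * 𝕏) * (G * G⁻¹) ^ 2 := by rw [← hG]; ring
    _ = _ := by rw [hinv]; ring

/-! ### The fixed point of the Schur step -/

/-- The Schur step with parameter `c` has a fixed point. -/
lemma exists_schur_fixedPoint (c : ℂ) :
    ∃ f : PowerSeries ℂ, f = 𝕏 * f - 𝕔 (conj c) + 𝕏 * (𝕔 c * (f * f)) := by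
  rcases eq_or_ne c 0 with rfl | hc
  · exact ⟨0, by simp⟩
  obtain ⟨R, hR, hR0, -⟩ := exists_sqrt_series (1 - c * conj c)
  have hQ : 𝕔 (4 * (1 - c * conj c)) = 4 - 4 * (𝕔 c * 𝕔 (conj c)) := by
    rw [← map_mul, map_mul, map_sub, map_one, show 𝕔 4 = 4 from map_ofNat 𝕔 4]
    ring
  rw [hQ] at hR
  -- For `u = c f` the equation is `X u^2 - (1-X) u - |c|^2 = 0`, with discriminant `R^2`. The root
  -- `(1-X-R)/(2X)` is a power series, and `v` is twice it.
  obtain ⟨v, hv⟩ : 𝕏 ∣ 1 - 𝕏 - R := by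
    rw [PowerSeries.X_dvd_iff]
    rw [PowerSeries.coeff_zero_eq_constantCoeff_apply] at hR0
    simp [hR0]
  have hX : 𝕏 ≠ 0 := PowerSeries.X_ne_zero
  have hh : 𝕔 (2⁻¹) * 2 = 1 := by
    rw [show (2 : PowerSeries ℂ) = 𝕔 2 from (map_ofNat 𝕔 2).symm, ← map_mul]; norm_num
  have hcc : 𝕔 c⁻¹ * 𝕔 c = 1 := by rw [← map_mul, inv_mul_cancel₀ hc, map_one]
  set u := 𝕔 (2⁻¹) * v with hu
  have huv : v = 2 * u := by linear_combination (-v) * hh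
  have hueq : u = 𝕏 * u - 𝕔 c * 𝕔 (conj c) + 𝕏 * u ^ 2 := by
    have h4 : (4 : PowerSeries ℂ) * 𝕏 ≠ 0 :=
      mul_ne_zero (by
        rw [← map_ofNat 𝕔 4]
        exact (map_ne_zero_iff _ PowerSeries.C_injective).2 (by norm_num)) hX
    refine mul_left_cancel₀ h4 ?_
    have hR' : R = 1 - 𝕏 - 𝕏 * (2 * u) := by rw [← huv]; linear_combination -hv
    rw [hR'] at hR
    linear_combination -hR
  refine ⟨𝕔 c⁻¹ * u, ?_⟩
  linear_combination 𝕔 c⁻¹ * hueq + (-𝕔 (conj c) - 𝕏 * u * u * 𝕔 c⁻¹) * hcc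

/-- The generating function of the limits of the logarithmic derivatives. -/
lemma coeff_succ_koebeTransform_eq {c : ℂ} {f h : PowerSeries ℂ}
    (hf : f = 𝕏 * f - 𝕔 (conj c) + 𝕏 * (𝕔 c * (f * f)))
    (hh : h * (1 - 𝕔 c * (𝕏 * f)) = 𝔡 (𝕔 c * (𝕏 * f))) (k : ℕ) :
    PowerSeries.coeff (k + 1) (koebeTransform (centralBinomSeries (1 - c * conj c))) =
      2 * PowerSeries.coeff k h := by
  obtain ⟨R, hR, hR0, hGR⟩ := exists_sqrt_series (1 - c * conj c)
  have hQ : 𝕔 (4 * (1 - c * conj c)) = 4 - 4 * (𝕔 c * 𝕔 (conj c)) := by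
    rw [← map_mul, map_mul, map_sub, map_one, show 𝕔 4 = 4 from map_ofNat 𝕔 4]
    ring
  rw [hQ] at hR
  set G := koebeTransform (centralBinomSeries (1 - c * conj c))
  set d := 𝕔 c * 𝕔 (conj c) with hd
  set u := 𝕔 c * (𝕏 * f) with hu
  have hu1 : u = 𝕏 * u - 𝕏 * d + u ^ 2 := by
    rw [hu, hd]
    linear_combination 𝕔 c * 𝕏 * hf
  have hRu : R = 1 - 𝕏 - 2 * u := by
    refine eq_of_sq_eq_sq_of_coeff_zero ?_ hR0 (by simp [hu])
    rw [hR]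
    linear_combination (4 : PowerSeries ℂ) * hu1
  have hder : 𝔡 u = u + 𝕏 * 𝔡 u - d + 2 * u * 𝔡 u := by
    have h1 := congrArg 𝔡 hu1
    simp only [map_add, map_sub, Derivation.leibniz, Derivation.leibniz_pow, smul_eq_mul,
      PowerSeries.derivative_X, nsmul_eq_mul, hd, PowerSeries.derivative_C] at h1
    push_cast at h1
    rw [hd]
    linear_combination h1
  have hne : 1 - u ≠ 0 := by
    intro h0
    simpa [hu] using congrArg (PowerSeries.coeff 0) h0
  -- Here `R u' = u - d` by `hder`, and `h (1-u) = u'`, so `X h R (1-u) = X (u-d) = u (1-u)` by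
  -- `hu1`.
  have hXh : 𝕏 * h * R = u := by
    refine mul_right_cancel₀ hne ?_
    rw [hRu]
    linear_combination 𝕏 * (1 - 𝕏 - 2 * u) * hh + 𝕏 * hder - hu1
  have hRne : R ≠ 0 := by rintro rfl; simp at hR0
  have hGh : G = 1 + 𝕏 * (2 * h) := by
    refine mul_right_cancel₀ hRne ?_
    linear_combination hGR - 2 * hXh - hRu
  rw [hGh, map_add, PowerSeries.coeff_succ_X_mul,
    show (2 : PowerSeries ℂ) = 𝕔 2 from (map_ofNat 𝕔 2).symm,
    PowerSeries.coeff_C_mul]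
  simp [PowerSeries.coeff_one]

/-! ### Arc measures and their moments -/

open Real (pi_pos)

/-- The point of the unit circle with argument `θ`, where `cos (θ / 2) = √(1 - a ^ 2) sin φ`. -/
def arcPoint (a φ : ℝ) : ℂ :=
  Complex.exp ((2 * Real.arccos (√(1 - a ^ 2) * Real.sin φ) : ℝ) * Complex.I)

/-- The uniform probability measure on `(-π / 2, π / 2)`. -/
def angleMeasure : Measure ℝ :=
  ENNReal.ofReal Real.pi⁻¹ • volume.restrict (Set.Ioo (-(Real.pi / 2)) (Real.pi / 2))

instance : IsProbabilityMeasure angleMeasure := by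
  constructor
  rw [angleMeasure, Measure.smul_apply, Measure.restrict_apply_univ, Real.volume_Ioo, smul_eq_mul,
    ← ENNReal.ofReal_mul (inv_nonneg.2 pi_pos.le), sub_neg_eq_add, add_halves,
    inv_mul_cancel₀ pi_pos.ne', ENNReal.ofReal_one]

lemma continuous_arcPoint : Continuous fun p : ℝ × ℝ => arcPoint p.1 p.2 := by
  unfold arcPoint
  fun_prop

lemma norm_arcPoint (a φ : ℝ) : ‖arcPoint a φ‖ = 1 := Complex.norm_exp_ofReal_mul_I _

lemma arcPoint_mul_conj (a φ : ℝ) : arcPoint a φ * conj (arcPoint a φ) = 1 := by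
  rw [Complex.mul_conj, Complex.normSq_eq_norm_sq, norm_arcPoint]; simp

lemma abs_sqrt_mul_sin_le (a φ : ℝ) : |√(1 - a ^ 2) * Real.sin φ| ≤ 1 := by
  rw [abs_mul, abs_of_nonneg (Real.sqrt_nonneg _)]
  refine mul_le_one₀ ?_ (abs_nonneg _) (Real.abs_sin_le_one φ)
  exact Real.sqrt_le_one.2 (by nlinarith [sq_nonneg a])

lemma two_add_arcPoint_add_conj {a : ℝ} (ha : a ^ 2 ≤ 1) (φ : ℝ) :
    2 + arcPoint a φ + conj (arcPoint a φ) =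
      ((4 * (1 - a ^ 2) * Real.sin φ ^ 2 : ℝ) : ℂ) := by
  have h := abs_le.1 (abs_sqrt_mul_sin_le a φ)
  rw [add_assoc, Complex.add_conj, arcPoint, Complex.exp_ofReal_mul_I_re, Real.cos_two_mul,
    Real.cos_arccos h.1 h.2, mul_pow, Real.sq_sqrt (by linarith)]
  push_cast
  ring

lemma arcPoint_neg (a φ : ℝ) : arcPoint a (-φ) = conj (arcPoint a φ) := by
  rw [arcPoint, arcPoint, Real.sin_neg, mul_neg, Real.arccos_neg, ← Complex.exp_conj]
  rw [Complex.exp_eq_exp_iff_exists_int]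
  refine ⟨1, ?_⟩
  simp only [map_mul, Complex.conj_ofReal, Complex.conj_I]
  push_cast
  ring

lemma integral_angleMeasure (F : ℝ → ℂ) :
    ∫ φ, F φ ∂angleMeasure =
      (Real.pi : ℂ)⁻¹ * ∫ φ in (-(Real.pi / 2))..(Real.pi / 2), F φ := by
  rw [angleMeasure, integral_smul_measure, intervalIntegral.integral_of_le (by linarith [pi_pos]),
    integral_Ioc_eq_integral_Ioo, ENNReal.toReal_ofReal (inv_nonneg.2 pi_pos.le),
    Complex.real_smul]
  push_cast
  rfl

lemma prod_odd_div_even (n : ℕ) :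
    ∏ i ∈ Finset.range n, (2 * (i : ℝ) + 1) / (2 * i + 2) = (n.centralBinom : ℝ) / 4 ^ n := by
  induction n with
  | zero => simp
  | succ n ih =>
    rw [Finset.prod_range_succ, ih]
    have h : ((n : ℝ) + 1) * ((n + 1).centralBinom : ℝ) =
        2 * (2 * n + 1) * (n.centralBinom : ℝ) := by
      exact_mod_cast Nat.succ_mul_centralBinom_succ n
    have h0 : (n : ℝ) + 1 ≠ 0 := by positivity
    rw [div_mul_div_comm, div_eq_div_iff (by positivity) (by positivity), pow_succ]
    linear_combination (-2 * 4 ^ n : ℝ) * h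

/-- Wallis' integral, moved from `[0, π]` by the period `π` of even powers of the sine. -/
lemma integral_sin_pow_angleMeasure (m : ℕ) :
    ∫ φ, ((Real.sin φ ^ 2 : ℝ) : ℂ) ^ m ∂angleMeasure = (m.centralBinom : ℂ) / 4 ^ m := by
  have hper : Function.Periodic (fun φ => Real.sin φ ^ (2 * m)) Real.pi := by
    intro φ
    simp only [Real.sin_add_pi, pow_mul, neg_sq]
  have h := hper.intervalIntegral_add_eq (-(Real.pi / 2)) 0
  rw [zero_add, integral_sin_pow_even, prod_odd_div_even,
    show -(Real.pi / 2) + Real.pi = Real.pi / 2 by ring] at h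
  rw [integral_angleMeasure]
  simp only [← Complex.ofReal_pow, ← pow_mul]
  rw [intervalIntegral.integral_ofReal, h]
  push_cast
  rw [inv_mul_cancel_left₀ (by exact_mod_cast pi_pos.ne')]

lemma integral_conj_arcPoint_pow (a : ℝ) (k : ℕ) :
    ∫ φ, conj (arcPoint a φ) ^ k ∂angleMeasure = ∫ φ, arcPoint a φ ^ k ∂angleMeasure := by
  rw [integral_angleMeasure, integral_angleMeasure]
  congr 1
  have h := intervalIntegral.integral_comp_neg (a := -(Real.pi / 2)) (b := Real.pi / 2)
    (fun φ => arcPoint a φ ^ k)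
  simpa only [arcPoint_neg, neg_neg] using h

lemma integrable_of_continuous_of_norm_le {F : ℝ → ℂ} (hF : Continuous F) {B : ℝ}
    (hB : ∀ φ, ‖F φ‖ ≤ B) : Integrable F angleMeasure :=
  Integrable.of_bound hF.aestronglyMeasurable B (ae_of_all _ hB)

lemma continuous_arcPoint_right (a : ℝ) : Continuous (arcPoint a) := by
  unfold arcPoint
  fun_prop

/-- The moments of the pushforward of the uniform measure under `arcPoint a`. -/
lemma two_mul_integral_conj_arcPoint_pow {a : ℝ} (ha : a ^ 2 ≤ 1) (k : ℕ) :
    2 * ∫ φ, conj (arcPoint a φ) ^ (k + 1) ∂angleMeasure =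
      PowerSeries.coeff (k + 1)
        (koebeTransform (centralBinomSeries ((1 - a ^ 2 : ℝ) : ℂ))) := by
  have hc := continuous_arcPoint_right a
  have hi1 : Integrable (fun φ => arcPoint a φ ^ (k + 1)) angleMeasure :=
    integrable_of_continuous_of_norm_le (hc.pow _) (B := 1) fun φ => by simp [norm_arcPoint]
  have hi2 : Integrable (fun φ => conj (arcPoint a φ) ^ (k + 1)) angleMeasure :=
    integrable_of_continuous_of_norm_le ((Complex.continuous_conj.comp hc).pow _) (B := 1)
      fun φ => by simp [norm_arcPoint]
  rw [two_mul]
  -- By the symmetry `φ ↦ -φ`, one of the two copies loses its conjugate, which produces the sum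
  -- expanded in `pow_add_pow_eq_sum`.
  nth_rewrite 1 [integral_conj_arcPoint_pow]
  rw [← integral_add hi1 hi2]
  simp only [pow_add_pow_eq_sum (arcPoint_mul_conj a _), two_add_arcPoint_add_conj ha]
  have hi3 : ∀ m, Integrable (fun φ => ((Real.sin φ ^ 2 : ℝ) : ℂ) ^ m) angleMeasure := fun m =>
    integrable_of_continuous_of_norm_le (by fun_prop) (B := 1) fun φ => by
      rw [norm_pow, Complex.norm_real, Real.norm_of_nonneg (sq_nonneg _)]
      exact pow_le_one₀ (sq_nonneg _) (Real.sin_sq_le_one φ)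
  have hsplit : ∀ (m : ℕ) (φ : ℝ), ((4 * (1 - a ^ 2) * Real.sin φ ^ 2 : ℝ) : ℂ) ^ m =
      (4 * ((1 - a ^ 2 : ℝ) : ℂ)) ^ m * ((Real.sin φ ^ 2 : ℝ) : ℂ) ^ m := fun m φ => by
    rw [← mul_pow]; push_cast; rfl
  simp only [hsplit]
  rw [integral_finsetSum _ fun m _ => ((hi3 m).const_mul _).mul_const _, coeff_koebeTransform]
  refine Finset.sum_congr rfl fun m _ => ?_
  rw [integral_mul_const, integral_const_mul, integral_sin_pow_angleMeasure, centralBinomSeries,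
    PowerSeries.coeff_mk]
  congr 1
  rw [mul_pow]
  field_simp

lemma image_two_mul_arccos {a : ℝ} (ha0 : 0 ≤ a) (ha1 : a < 1) :
    (fun φ => 2 * Real.arccos (√(1 - a ^ 2) * Real.sin φ)) ''
      Set.Ioo (-(Real.pi / 2)) (Real.pi / 2) =
      Set.Ioo (arcAngle a) (2 * Real.pi - arcAngle a) := by
  have hb : 0 < √(1 - a ^ 2) := Real.sqrt_pos.2 (by nlinarith)
  have hb1 : √(1 - a ^ 2) ≤ 1 := Real.sqrt_le_one.2 (by nlinarith)
  have hcos : Real.cos (Real.arcsin a) = √(1 - a ^ 2) := Real.cos_arcsin a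
  have harc0 : 0 ≤ Real.arcsin a := Real.arcsin_nonneg.2 ha0
  have harc1 : Real.arcsin a ≤ Real.pi / 2 := Real.arcsin_le_pi_div_two a
  have harccos : Real.arccos √(1 - a ^ 2) = Real.arcsin a := by
    rw [← hcos, Real.arccos_cos harc0 (by linarith [pi_pos])]
  set b := √(1 - a ^ 2)
  ext θ
  simp only [Set.mem_image, Set.mem_Ioo, arcAngle]
  constructor
  · rintro ⟨φ, ⟨h1, h2⟩, rfl⟩
    have hs1 : Real.sin φ < 1 := by
      rw [← Real.sin_pi_div_two]
      exact Real.sin_lt_sin_of_lt_of_le_pi_div_two h1.le le_rfl h2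
    have hs2 : -1 < Real.sin φ := by
      rw [← Real.sin_pi_div_two, ← Real.sin_neg]
      exact Real.sin_lt_sin_of_lt_of_le_pi_div_two le_rfl h2.le h1
    have h3 : Real.arcsin a < Real.arccos (b * Real.sin φ) := by
      rw [← harccos]
      exact Real.strictAntiOn_arccos ⟨by nlinarith, by nlinarith⟩ ⟨by linarith, hb1⟩ (by nlinarith)
    have h4 : Real.arccos (b * Real.sin φ) < Real.pi - Real.arcsin a := by
      rw [← harccos, ← Real.arccos_neg]
      exact Real.strictAntiOn_arccos ⟨by linarith, by linarith⟩ ⟨by nlinarith, by nlinarith⟩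
        (by nlinarith)
    constructor <;> linarith
  · rintro ⟨h1, h2⟩
    have hc1 : Real.cos (θ / 2) < b := by
      rw [← hcos]
      exact Real.cos_lt_cos_of_nonneg_of_le_pi harc0 (by linarith) (by linarith)
    have hc2 : -b < Real.cos (θ / 2) := by
      rw [← hcos, ← Real.cos_pi_sub]
      exact Real.cos_lt_cos_of_nonneg_of_le_pi (by linarith) (by linarith) (by linarith)
    have hd1 : Real.cos (θ / 2) / b < 1 := (div_lt_one hb).2 hc1
    have hd2 : -1 < Real.cos (θ / 2) / b := by rw [lt_div_iff₀ hb]; linarith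
    refine ⟨Real.arcsin (Real.cos (θ / 2) / b),
      ⟨Real.neg_pi_div_two_lt_arcsin.2 hd2, Real.arcsin_lt_pi_div_two.2 hd1⟩, ?_⟩
    rw [Real.sin_arcsin hd2.le hd1.le, mul_div_cancel₀ _ hb.ne',
      Real.arccos_cos (by linarith) (by linarith)]
    ring

lemma mul_sin_sq_lt_one {b φ : ℝ} (hb0 : 0 ≤ b) (hb1 : b ≤ 1)
    (hφ : φ ∈ Set.Ioo (-(Real.pi / 2)) (Real.pi / 2)) : (b * Real.sin φ) ^ 2 < 1 := by
  have hcos : 0 < Real.cos φ := Real.cos_pos_of_mem_Ioo hφ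
  rw [mul_pow]
  calc b ^ 2 * Real.sin φ ^ 2 ≤ 1 * Real.sin φ ^ 2 :=
        mul_le_mul_of_nonneg_right (pow_le_one₀ hb0 hb1) (sq_nonneg _)
    _ = 1 - Real.cos φ ^ 2 := by rw [one_mul, Real.sin_sq]
    _ < 1 := by linarith [pow_pos hcos 2]

lemma hasDerivAt_two_mul_arccos {b φ : ℝ} (hb0 : 0 ≤ b) (hb1 : b ≤ 1)
    (hφ : φ ∈ Set.Ioo (-(Real.pi / 2)) (Real.pi / 2)) :
    HasDerivAt (fun φ => 2 * Real.arccos (b * Real.sin φ))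
      (-(2 * (b * Real.cos φ) / √(1 - (b * Real.sin φ) ^ 2))) φ := by
  have hs : (b * Real.sin φ) ^ 2 < 1 := mul_sin_sq_lt_one hb0 hb1 hφ
  have h1 : b * Real.sin φ ≠ -1 := fun h => by rw [h] at hs; norm_num at hs
  have h2 : b * Real.sin φ ≠ 1 := fun h => by rw [h] at hs; norm_num at hs
  have h3 := ((Real.hasDerivAt_arccos h1 h2).comp φ
    ((Real.hasDerivAt_sin φ).const_mul b)).const_mul 2
  refine h3.congr_deriv ?_
  ring

/-- With `b = √(1-a^2)`, the numerator `sin (θ/2)` is `√(1 - b^2 sin^2 φ)` and the denominator is `b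
cos φ`; the Jacobian cancels both. -/
lemma abs_deriv_mul_arcDensity {a φ : ℝ} (ha0 : 0 ≤ a) (ha1 : a < 1)
    (hφ : φ ∈ Set.Ioo (-(Real.pi / 2)) (Real.pi / 2)) :
    |-(2 * (√(1 - a ^ 2) * Real.cos φ) / √(1 - (√(1 - a ^ 2) * Real.sin φ) ^ 2))| *
      arcDensity a (2 * Real.arccos (√(1 - a ^ 2) * Real.sin φ)) = Real.pi⁻¹ := by
  have hb : 0 < √(1 - a ^ 2) := Real.sqrt_pos.2 (by nlinarith)
  have hb1 : √(1 - a ^ 2) ≤ 1 := Real.sqrt_le_one.2 (by nlinarith)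
  have hcos : 0 < Real.cos φ := Real.cos_pos_of_mem_Ioo hφ
  have habs := abs_le.1 (abs_sqrt_mul_sin_le a φ)
  have hdens : arcDensity a (2 * Real.arccos (√(1 - a ^ 2) * Real.sin φ)) =
      1 / (2 * Real.pi) * (√(1 - (√(1 - a ^ 2) * Real.sin φ) ^ 2) /
        √(√(1 - a ^ 2) ^ 2 - (√(1 - a ^ 2) * Real.sin φ) ^ 2)) := by
    rw [arcDensity, arcAngle, mul_div_cancel_left₀ _ two_ne_zero,
      mul_div_cancel_left₀ _ two_ne_zero, Real.cos_arcsin, Real.sin_arccos,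
      Real.cos_arccos habs.1 habs.2]
  rw [hdens]
  set b := √(1 - a ^ 2)
  have hs : (b * Real.sin φ) ^ 2 < 1 := mul_sin_sq_lt_one hb.le hb1 hφ
  have hq : 0 < √(1 - (b * Real.sin φ) ^ 2) := Real.sqrt_pos.2 (by linarith)
  have hr : √(b ^ 2 - (b * Real.sin φ) ^ 2) = b * Real.cos φ := by
    rw [show b ^ 2 - (b * Real.sin φ) ^ 2 = (b * Real.cos φ) ^ 2 by
      rw [mul_pow, mul_pow, Real.cos_sq']; ring]
    exact Real.sqrt_sq (by positivity)
  rw [hr, abs_neg, abs_of_nonneg (by positivity)]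
  have := pi_pos.ne'
  set q := √(1 - (b * Real.sin φ) ^ 2)
  field_simp

lemma injOn_two_mul_arccos {b : ℝ} (hb0 : 0 < b) (hb1 : b ≤ 1) :
    Set.InjOn (fun φ => 2 * Real.arccos (b * Real.sin φ))
      (Set.Ioo (-(Real.pi / 2)) (Real.pi / 2)) := by
  intro x hx y hy hxy
  have hm : ∀ z, b * Real.sin z ∈ Set.Icc (-1 : ℝ) 1 := fun z =>
    ⟨by nlinarith [Real.neg_one_le_sin z], by nlinarith [Real.sin_le_one z]⟩
  have h1 : Real.arccos (b * Real.sin x) = Real.arccos (b * Real.sin y) := by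
    simpa using hxy
  have h2 := Real.strictAntiOn_arccos.injOn (hm x) (hm y) h1
  have h3 := mul_left_cancel₀ hb0.ne' h2
  exact Real.injOn_sin (Set.Ioo_subset_Icc_self hx) (Set.Ioo_subset_Icc_self hy) h3

/-- The arc measure is the image of a uniform measure. -/
lemma arcMeasure_eq_map {a : ℝ} (ha0 : 0 ≤ a) (ha1 : a ≤ 1) :
    arcMeasure a = angleMeasure.map (arcPoint a) := by
  rcases ha1.eq_or_lt with rfl | ha1
  · have h : arcPoint 1 = fun _ => (-1 : ℂ) := by
      funext φ
      simp only [arcPoint, one_pow, sub_self, Real.sqrt_zero, zero_mul, Real.arccos_zero]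
      rw [mul_div_cancel₀ _ two_ne_zero, Complex.exp_pi_mul_I]
    rw [arcMeasure, if_pos rfl, h, Measure.map_const, measure_univ, one_smul]
  · have hb : 0 < √(1 - a ^ 2) := Real.sqrt_pos.2 (by nlinarith)
    have hb1 : √(1 - a ^ 2) ≤ 1 := Real.sqrt_le_one.2 (by nlinarith)
    rw [arcMeasure, if_neg ha1.ne]
    have hexp : Measurable fun θ : ℝ => Complex.exp (θ * Complex.I) := by fun_prop
    ext s hs
    rw [Measure.map_apply hexp hs, Measure.map_apply (continuous_arcPoint_right a).measurable hs,
      withDensity_apply _ (hexp hs), ← lintegral_indicator (hexp hs),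
      setLIntegral_congr Ioo_ae_eq_Icc.symm, ← image_two_mul_arccos ha0 ha1,
      lintegral_image_eq_lintegral_abs_deriv_mul measurableSet_Ioo
        (fun φ hφ => (hasDerivAt_two_mul_arccos hb.le hb1 hφ).hasDerivWithinAt)
        (injOn_two_mul_arccos hb hb1)]
    have hpre : MeasurableSet (arcPoint a ⁻¹' s) := (continuous_arcPoint_right a).measurable hs
    rw [angleMeasure, Measure.smul_apply, smul_eq_mul, ← setLIntegral_one,
      ← lintegral_indicator hpre, ← lintegral_const_mul _ (measurable_const.indicator hpre)]
    refine setLIntegral_congr_fun measurableSet_Ioo fun φ hφ => ?_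
    by_cases h : arcPoint a φ ∈ s
    · have h1 : φ ∈ arcPoint a ⁻¹' s := h
      have h2 : 2 * Real.arccos (√(1 - a ^ 2) * Real.sin φ) ∈
          (fun θ : ℝ => Complex.exp (θ * Complex.I)) ⁻¹' s := h
      simp only [Set.indicator_of_mem h1, Set.indicator_of_mem h2]
      rw [← ENNReal.ofReal_mul (abs_nonneg _), abs_deriv_mul_arcDensity ha0 ha1 hφ, mul_one]
    · have h1 : φ ∉ arcPoint a ⁻¹' s := h
      have h2 : 2 * Real.arccos (√(1 - a ^ 2) * Real.sin φ) ∉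
          (fun θ : ℝ => Complex.exp (θ * Complex.I)) ⁻¹' s := h
      simp only [Set.indicator_of_notMem h1, Set.indicator_of_notMem h2, mul_zero]

/-! ### The averaged measure -/

lemma measurable_map_arcPoint : Measurable fun a => angleMeasure.map (arcPoint a) := by
  refine Measure.measurable_of_measurable_coe _ fun s hs => ?_
  simp only [Measure.map_apply (continuous_arcPoint_right _).measurable hs]
  exact measurable_measure_prodMk_left (continuous_arcPoint.measurable hs)

lemma measurable_arcPoint_comp {r : ℝ → ℝ} (hr : Measurable r) :
    Measurable fun p : ℝ × ℝ => arcPoint (r p.1) p.2 := by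
  unfold arcPoint
  fun_prop

/-- The uniform probability measure on `[0, t]`. -/
def uniformIcc (t : ℝ) : Measure ℝ := ENNReal.ofReal t⁻¹ • volume.restrict (Set.Icc 0 t)

lemma isProbabilityMeasure_uniformIcc {t : ℝ} (ht : 0 < t) :
    IsProbabilityMeasure (uniformIcc t) := by
  constructor
  rw [uniformIcc, Measure.smul_apply, Measure.restrict_apply_univ, Real.volume_Icc, smul_eq_mul,
    ← ENNReal.ofReal_mul (inv_nonneg.2 ht.le), sub_zero, inv_mul_cancel₀ ht.ne',
    ENNReal.ofReal_one]

/-- The Borel function `r` stands in for `|α|`, and changing the family on a null set does not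
affect the average. As a pushforward of a product probability, the average is visibly a probability
measure. -/
lemma averageArcMeasure_eq_map {t : ℝ} {α : ℝ → ℂ} {r : ℝ → ℝ} (hr : Measurable r)
    (hαr : ∀ᵐ s ∂volume.restrict (Set.Icc 0 t), ‖α s‖ = r s)
    (hα : ∀ s ∈ Set.Icc 0 t, ‖α s‖ ≤ 1) :
    averageArcMeasure t α =
      ((uniformIcc t).prod angleMeasure).map fun p => arcPoint (r p.1) p.2 := by
  have hmeas := measurable_arcPoint_comp hr
  have hcongr : (fun s => arcMeasure ‖α s‖) =ᵐ[volume.restrict (Set.Icc 0 t)]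
      fun s => angleMeasure.map (arcPoint (r s)) := by
    filter_upwards [hαr, ae_restrict_mem measurableSet_Icc] with s hs hst
    rw [arcMeasure_eq_map (norm_nonneg _) (hα s hst), hs]
  rw [averageArcMeasure, Measure.bind_congr_right hcongr, ← Measure.bind_smul]
  change (uniformIcc t).bind _ = _
  have hm : Measurable fun s => angleMeasure.map (arcPoint (r s)) :=
    measurable_map_arcPoint.comp hr
  ext S hS
  rw [Measure.bind_apply hS hm.aemeasurable, Measure.map_apply hmeas hS,
    Measure.prod_apply (hmeas hS)]
  refine lintegral_congr fun s => ?_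
  rw [Measure.map_apply (continuous_arcPoint_right _).measurable hS]
  rfl

/-! ### Weak convergence from moments -/

lemma exists_trigPolynomial_near {f : ℂ → ℂ} (hf : Continuous f) {ε : ℝ} (hε : 0 < ε) :
    ∃ c : ℤ →₀ ℂ, ∀ w : ℂ, ‖w‖ = 1 → ‖f w - ∑ i ∈ c.support, c i * w ^ i‖ ≤ ε := by
  have : Fact (0 < 2 * Real.pi) := ⟨Real.two_pi_pos⟩
  let g : C(AddCircle (2 * Real.pi), ℂ) :=
    ⟨fun x => f (AddCircle.toCircle x),
      hf.comp (continuous_subtype_val.comp AddCircle.continuous_toCircle)⟩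
  have hg : g ∈ (Submodule.span ℂ
      (Set.range <| fourier (T := 2 * Real.pi))).topologicalClosure := by
    rw [span_fourier_closure_eq_top]; trivial
  obtain ⟨p, hp, hgp⟩ := Metric.mem_closure_iff.1 hg ε hε
  obtain ⟨c, rfl⟩ := (Finsupp.mem_span_range_iff_exists_finsupp).1 hp
  refine ⟨c, fun w hw => ?_⟩
  obtain ⟨x, hx⟩ : ∃ x : AddCircle (2 * Real.pi), (AddCircle.toCircle x : ℂ) = w := by
    refine ⟨(w.arg : ℝ), ?_⟩
    rw [AddCircle.toCircle_apply_mk, div_self Real.two_pi_pos.ne', one_mul, Circle.coe_exp]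
    simpa [hw] using Complex.norm_mul_exp_arg_mul_I w
  have h1 := (ContinuousMap.dist_apply_le_dist (f := g) (g := c.sum fun i a => a • fourier i)
    x).trans hgp.le
  rw [dist_eq_norm] at h1
  refine le_of_eq_of_le ?_ h1
  congr 2
  · simp [g, hx]
  · rw [Finsupp.sum, ContinuousMap.sum_apply]
    refine Finset.sum_congr rfl fun i _ => ?_
    rw [ContinuousMap.smul_apply, fourier_apply, AddCircle.toCircle_zsmul, Circle.coe_zpow, hx,
      smul_eq_mul]

lemma integrable_zpow_of_ae_norm_eq_one {μ : Measure ℂ} [IsFiniteMeasure μ]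
    (hμ : ∀ᵐ w ∂μ, ‖w‖ = 1) (i : ℤ) : Integrable (fun w : ℂ => w ^ i) μ := by
  refine Integrable.of_bound (by fun_prop) 1 ?_
  filter_upwards [hμ] with w hw
  rw [norm_zpow, hw, one_zpow]

lemma integral_conj_pow_eq {μ : Measure ℂ} (hμ : ∀ᵐ w ∂μ, ‖w‖ = 1) (k : ℕ) :
    ∫ w, conj w ^ k ∂μ = ∫ w : ℂ, w ^ (-(k : ℤ)) ∂μ := by
  refine integral_congr_ae ?_
  filter_upwards [hμ] with w hw
  rw [zpow_neg, zpow_natCast, ← inv_pow, Complex.inv_def, Complex.normSq_eq_norm_sq, hw]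
  simp

/-- Convergence of moments implies weak convergence for measures on the unit circle. -/
lemma tendsto_of_tendsto_moments {ι : Type*} {l : Filter ι} {μ : ι → FiniteMeasure ℂ}
    {σ : FiniteMeasure ℂ} (hμ1 : ∀ j, (μ j : Measure ℂ).real Set.univ ≤ 1)
    (hσ1 : (σ : Measure ℂ).real Set.univ ≤ 1)
    (hμ : ∀ j, ∀ᵐ w ∂(μ j : Measure ℂ), ‖w‖ = 1) (hσ : ∀ᵐ w ∂(σ : Measure ℂ), ‖w‖ = 1)
    (hmom : ∀ k : ℕ, Tendsto (fun j => ∫ w, conj w ^ k ∂(μ j : Measure ℂ)) l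
      (𝓝 (∫ w, conj w ^ k ∂(σ : Measure ℂ)))) :
    Tendsto μ l (𝓝 σ) := by
  -- On the circle the given moments are the nonpositive powers; conjugation supplies the others.
  have hz : ∀ i : ℤ, Tendsto (fun j => ∫ w : ℂ, w ^ i ∂(μ j : Measure ℂ)) l
      (𝓝 (∫ w : ℂ, w ^ i ∂(σ : Measure ℂ))) := by
    intro i
    rcases Int.eq_nat_or_neg i with ⟨k, rfl | rfl⟩
    · have h := (Complex.continuous_conj.tendsto _).comp (hmom k)
      simp only [Function.comp_def, ← integral_conj, map_pow, Complex.conj_conj] at h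
      simpa only [zpow_natCast] using h
    · simpa only [integral_conj_pow_eq (hμ _), integral_conj_pow_eq hσ] using hmom k
  rw [FiniteMeasure.tendsto_iff_forall_integral_tendsto]
  intro f
  have hfc : Continuous fun w : ℂ => ((f w : ℝ) : ℂ) := Complex.continuous_ofReal.comp f.continuous
  suffices h : Tendsto (fun j => ∫ w, ((f w : ℝ) : ℂ) ∂(μ j : Measure ℂ)) l
      (𝓝 (∫ w, ((f w : ℝ) : ℂ) ∂(σ : Measure ℂ))) by
    simp only [integral_complex_ofReal] at h
    exact_mod_cast (Complex.continuous_re.tendsto _).comp h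
  rw [Metric.tendsto_nhds]
  intro ε hε
  obtain ⟨c, hc⟩ := exists_trigPolynomial_near hfc (show 0 < ε / 3 by positivity)
  have hp : Tendsto (fun j => ∫ w : ℂ, ∑ i ∈ c.support, c i * w ^ i ∂(μ j : Measure ℂ)) l
      (𝓝 (∫ w : ℂ, ∑ i ∈ c.support, c i * w ^ i ∂(σ : Measure ℂ))) := by
    have hsum : ∀ ν : FiniteMeasure ℂ, (∀ᵐ w ∂(ν : Measure ℂ), ‖w‖ = 1) →
        ∫ w : ℂ, ∑ i ∈ c.support, c i * w ^ i ∂(ν : Measure ℂ) =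
          ∑ i ∈ c.support, c i * ∫ w : ℂ, w ^ i ∂(ν : Measure ℂ) := fun ν hν => by
      rw [integral_finsetSum _ fun i _ => (integrable_zpow_of_ae_norm_eq_one hν i).const_mul _]
      simp only [integral_const_mul]
    simp only [hsum _ (hμ _), hsum _ hσ]
    exact tendsto_finsetSum _ fun i _ => (hz i).const_mul _
  have hnear : ∀ ν : FiniteMeasure ℂ, (ν : Measure ℂ).real Set.univ ≤ 1 →
      (∀ᵐ w ∂(ν : Measure ℂ), ‖w‖ = 1) →
      dist (∫ w, ((f w : ℝ) : ℂ) ∂(ν : Measure ℂ))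
        (∫ w : ℂ, ∑ i ∈ c.support, c i * w ^ i ∂(ν : Measure ℂ)) ≤ ε / 3 := by
    intro ν hν1 hν
    rw [dist_eq_norm, ← integral_sub]
    · refine (norm_integral_le_of_norm_le_const (C := ε / 3) ?_).trans
        (mul_le_of_le_one_right (by positivity) hν1)
      filter_upwards [hν] with w hw using hc w hw
    · exact (f.integrable (ν : Measure ℂ)).ofReal
    · exact integrable_finsetSum _ fun i _ =>
        (integrable_zpow_of_ae_norm_eq_one hν i).const_mul _
  filter_upwards [Metric.tendsto_nhds.1 hp (ε / 3) (by positivity)] with j hj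
  have h1 := hnear (μ j) (hμ1 j) (hμ j)
  have h2 := hnear σ hσ1 hσ
  rw [dist_comm] at h2
  calc _ ≤ _ := dist_triangle4 _ _ _ _
    _ < ε / 3 + ε / 3 + ε / 3 := add_lt_add_of_lt_of_le (add_lt_add_of_le_of_lt h1 hj) h2
    _ = ε := by ring

/-! ### Moments of the zero-counting measures and their limits -/

lemma integral_sum_diracMass (s : Multiset ℂ) (F : ℂ → ℂ) :
    Integrable F ((s.map diracMass).sum : FiniteMeasure ℂ) ∧
      ∫ w, F w ∂((s.map diracMass).sum : FiniteMeasure ℂ) = (s.map F).sum := by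
  induction s using Multiset.induction_on with
  | empty => simp
  | cons z s ih =>
    have hz : Integrable F (diracMass z : Measure ℂ) := by
      change Integrable F (Measure.dirac z)
      exact integrable_dirac (by simp)
    simp only [Multiset.map_cons, Multiset.sum_cons, FiniteMeasure.toMeasure_add]
    refine ⟨hz.add_measure ih.1, ?_⟩
    rw [integral_add_measure hz ih.1, ih.2]
    congr 1
    exact integral_dirac F z

lemma ae_sum_diracMass {s : Multiset ℂ} {p : ℂ → Prop} (hp : ∀ z ∈ s, p z) :
    ∀ᵐ w ∂((s.map diracMass).sum : FiniteMeasure ℂ).toMeasure, p w := by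
  induction s using Multiset.induction_on with
  | empty => simp
  | cons z s ih =>
    simp only [Multiset.map_cons, Multiset.sum_cons, FiniteMeasure.toMeasure_add]
    rw [ae_add_measure_iff]
    refine ⟨?_, ih fun w hw => hp w (Multiset.mem_cons_of_mem hw)⟩
    change ∀ᵐ w ∂Measure.dirac z, p w
    rw [ae_dirac_eq]
    exact hp z (Multiset.mem_cons_self z s)

lemma integral_popucZeroMeasure (a : ℕ → ℂ) (β : ℂ) (n : ℕ) (F : ℂ → ℂ) :
    ∫ w, F w ∂(popucZeroMeasure a β n : Measure ℂ) =
      (n : ℂ)⁻¹ * ((popuc a β n).roots.map F).sum := by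
  rw [popucZeroMeasure, FiniteMeasure.toMeasure_smul, integral_smul_nnreal_measure,
    (integral_sum_diracMass _ F).2, NNReal.smul_def, Complex.real_smul]
  push_cast
  rfl

lemma ae_norm_eq_one_popucZeroMeasure {a : ℕ → ℂ} (ha : ∀ k, ‖a k‖ ≤ 1) {β : ℂ} (hβ : ‖β‖ = 1)
    (n : ℕ) : ∀ᵐ w ∂(popucZeroMeasure a β n : Measure ℂ), ‖w‖ = 1 := by
  rw [popucZeroMeasure, FiniteMeasure.toMeasure_smul]
  exact Measure.smul_absolutelyContinuous.ae_le
    (ae_sum_diracMass fun z hz => norm_eq_one_of_mem_roots_popuc ha hβ hz)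

/-- The mass is `0` for `n = 0` and `1` otherwise, which is why the moment criterion only asks for
mass at most one. -/
lemma real_univ_popucZeroMeasure (a : ℕ → ℂ) (β : ℂ) (n : ℕ) :
    (popucZeroMeasure a β n : Measure ℂ).real Set.univ = (n : ℝ)⁻¹ * n := by
  have h := integral_popucZeroMeasure a β n fun _ => 1
  rw [Multiset.map_const', Multiset.sum_replicate, card_roots_popuc, integral_const] at h
  simp only [Complex.real_smul, mul_one, nsmul_eq_mul] at h
  exact Complex.ofReal_injective (by push_cast; exact h)

lemma schurSeries_congr {a b : ℕ → ℂ} {n : ℕ} (h : ∀ k < n, a k = b k) :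
    schurSeries a n = schurSeries b n := by
  induction n with
  | zero => rfl
  | succ n ih =>
    rw [schurSeries, schurSeries, ih fun k hk => h k (hk.trans n.lt_succ_self),
      h n n.lt_succ_self]

lemma stepLogDeriv_congr {a b : ℕ → ℂ} {n : ℕ} (h : ∀ k ≤ n, a k = b k) :
    stepLogDeriv a n = stepLogDeriv b n := by
  rw [stepLogDeriv, stepLogDeriv, schurSeries_congr fun k hk => h k hk.le, h n le_rfl]

/-- The moments of the zero-counting measure are averages along the recurrence, up to an error of
order `1 / n` produced by the last coefficient. -/
lemma exists_norm_moment_sub_average_le (k : ℕ) : ∃ B : ℝ, ∀ (a : ℕ → ℂ), (∀ i, ‖a i‖ ≤ 1) →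
    ∀ β : ℂ, ‖β‖ = 1 → ∀ n : ℕ,
      ‖∫ w, conj w ^ (k + 1) ∂(popucZeroMeasure a β n : Measure ℂ) -
        (n : ℂ)⁻¹ * ∑ i ∈ Finset.range n, PowerSeries.coeff k (stepLogDeriv a i)‖ ≤ B / n := by
  obtain ⟨B, hB⟩ := exists_bound_coeff_stepLogDeriv
  refine ⟨B k + B k, fun a ha β hβ n => ?_⟩
  cases n with
  | zero => simp [integral_popucZeroMeasure]
  | succ n =>
    have hu : ∀ i, ‖Function.update a n β i‖ ≤ 1 := by
      intro i
      by_cases hi : i = n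
      · subst hi; simp [hβ]
      · simpa [hi] using ha i
    rw [integral_popucZeroMeasure, popuc_succ_eq_opuc, sum_conj_pow_roots_opuc,
      Finset.sum_range_succ, Finset.sum_range_succ, ← mul_sub]
    have hsum : ∀ i ∈ Finset.range n,
        PowerSeries.coeff k (stepLogDeriv (Function.update a n β) i) =
          PowerSeries.coeff k (stepLogDeriv a i) := by
      intro i hi
      rw [stepLogDeriv_congr fun m hm => Function.update_of_ne
        (hm.trans_lt (Finset.mem_range.1 hi)).ne _ _]
    rw [Finset.sum_congr rfl hsum, add_sub_add_left_eq_sub, norm_mul, norm_inv,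
      Complex.norm_natCast, mul_comm, ← div_eq_mul_inv]
    exact div_le_div_of_nonneg_right ((norm_sub_le _ _).trans (add_le_add (hB k _ hu n)
      (hB k a ha n))) (Nat.cast_nonneg _)

/-- The limit of the logarithmic derivatives is given by the moments of the arc measure. -/
lemma ratioTendsto_coeff_stepLogDeriv_arcPoint {A : ℕ → ℕ → ℂ} {s : ℝ} {c : ℂ} (hc : ‖c‖ ≤ 1)
    (hA : RatioTendsto A s c) (k : ℕ) :
    RatioTendsto (fun n N => PowerSeries.coeff k (stepLogDeriv (fun i => A i N) n)) s
      (∫ φ, conj (arcPoint ‖c‖ φ) ^ (k + 1) ∂angleMeasure) := by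
  obtain ⟨f, hf⟩ := exists_schur_fixedPoint c
  obtain ⟨h, hh⟩ : ∃ h, h * (1 - 𝕔 c * (𝕏 * f)) = 𝔡 (𝕔 c * (𝕏 * f)) :=
    ⟨𝔡 (𝕔 c * (𝕏 * f)) * (1 - 𝕔 c * (𝕏 * f))⁻¹, by
      rw [mul_assoc, inv_one_sub_mul_cancel, mul_one]⟩
  have h1 := two_mul_integral_conj_arcPoint_pow (a := ‖c‖) (pow_le_one₀ (norm_nonneg c) hc) k
  have hq : ((1 - ‖c‖ ^ 2 : ℝ) : ℂ) = 1 - c * conj c := by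
    rw [Complex.mul_conj, Complex.normSq_eq_norm_sq]; push_cast; rfl
  rw [hq, coeff_succ_koebeTransform_eq hf hh] at h1
  rw [mul_left_cancel₀ two_ne_zero h1]
  exact ratioTendsto_coeff_stepLogDeriv hA hf hh k

lemma integral_averageArcMeasure {t : ℝ} (ht : 0 < t) {α : ℝ → ℂ} {r : ℝ → ℝ} (hr : Measurable r)
    (hαr : ∀ᵐ s ∂volume.restrict (Set.Icc 0 t), ‖α s‖ = r s)
    (hα : ∀ s ∈ Set.Icc 0 t, ‖α s‖ ≤ 1) (k : ℕ) :
    ∫ w, conj w ^ k ∂(averageArcMeasure t α) =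
      (t : ℂ)⁻¹ * ∫ s in Set.Icc 0 t, ∫ φ, conj (arcPoint ‖α s‖ φ) ^ k ∂angleMeasure := by
  have := isProbabilityMeasure_uniformIcc ht
  have hmeas := measurable_arcPoint_comp hr
  have hF : Continuous fun w : ℂ => conj w ^ k := Complex.continuous_conj.pow k
  have hint : Integrable (fun p : ℝ × ℝ => conj (arcPoint (r p.1) p.2) ^ k)
      ((uniformIcc t).prod angleMeasure) := by
    refine Integrable.of_bound (hF.measurable.comp hmeas).aestronglyMeasurable 1
      (ae_of_all _ fun p => ?_)
    simp [norm_arcPoint]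
  rw [averageArcMeasure_eq_map hr hαr hα,
    integral_map hmeas.aemeasurable hF.aestronglyMeasurable, integral_prod _ hint, uniformIcc,
    integral_smul_measure, ENNReal.toReal_ofReal (inv_nonneg.2 ht.le), Complex.real_smul]
  push_cast
  congr 1
  refine integral_congr_ae ?_
  filter_upwards [hαr] with s hs
  rw [hs]

end VaryingPOPUC

/-! ### The main theorem -/

theorem theorem4p1 (t : ℝ) (ht : 0 < t) (α : ℝ → ℂ)
    (hα_meas : NullMeasurable α (volume.restrict (Set.Icc 0 t)))
    (hα : ∀ s ∈ Set.Icc 0 t, ‖α s‖ ≤ 1)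
    (A : ℕ → ℕ → ℂ) (hA : ∀ n N, ‖A n N‖ < 1)
    (hlim : ∀ᵐ s ∂(volume.restrict (Set.Icc 0 t)), VaryingPOPUC.RatioTendsto A s (α s)) :
    ∃ σ : ProbabilityMeasure ℂ,
      (σ : Measure ℂ) = VaryingPOPUC.averageArcMeasure t α ∧
      ∀ β : ℂ, ‖β‖ = 1 →
        VaryingPOPUC.RatioTendsto
          (fun n N => VaryingPOPUC.popucZeroMeasure (fun k => A k N) β n) t
          σ.toFiniteMeasure := by
  open VaryingPOPUC in
  have hα' : AEMeasurable α (volume.restrict (Set.Icc 0 t)) := hα_meas.aemeasurable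
  set r : ℝ → ℝ := fun s => ‖hα'.mk α s‖
  have hr : Measurable r := hα'.measurable_mk.norm
  have hαr : ∀ᵐ s ∂volume.restrict (Set.Icc 0 t), ‖α s‖ = r s := by
    filter_upwards [hα'.ae_eq_mk] with s hs
    simp only [r, ← hs]
  have hmeas := measurable_arcPoint_comp hr
  have heq := averageArcMeasure_eq_map hr hαr hα
  have := isProbabilityMeasure_uniformIcc ht
  have hprob : IsProbabilityMeasure (averageArcMeasure t α) := by
    rw [heq]
    exact Measure.isProbabilityMeasure_map hmeas.aemeasurable
  refine ⟨⟨averageArcMeasure t α, hprob⟩, rfl, fun β hβ n N hn hN hnN => ?_⟩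
  have hnorm : ∀ᵐ w ∂averageArcMeasure t α, ‖w‖ = 1 := by
    rw [heq, ae_map_iff hmeas.aemeasurable (measurableSet_eq_fun measurable_norm measurable_const)]
    exact ae_of_all _ fun p => norm_arcPoint _ _
  refine tendsto_of_tendsto_moments (fun j => ?_)
    (le_of_eq (probReal_univ (μ := averageArcMeasure t α)))
    (fun j => ae_norm_eq_one_popucZeroMeasure (fun k => (hA k (N j)).le) hβ (n j)) hnorm
    fun k => ?_
  · rw [real_univ_popucZeroMeasure]
    exact inv_mul_le_one
  have hev : ∀ᶠ j in atTop, n j ≠ 0 := by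
    filter_upwards [hn.eventually_ge_atTop 1] with j hj using by omega
  change Tendsto _ _ (𝓝 (∫ w, _ ∂averageArcMeasure t α))
  cases k with
  | zero =>
    simp only [pow_zero, integral_const, probReal_univ, one_smul, real_univ_popucZeroMeasure]
    refine tendsto_const_nhds.congr' ?_
    filter_upwards [hev] with j hj
    rw [inv_mul_cancel₀ (Nat.cast_ne_zero.2 hj), one_smul]
  | succ k =>
    obtain ⟨B, hB⟩ := exists_bound_coeff_stepLogDeriv
    obtain ⟨D, hD⟩ := exists_norm_moment_sub_average_le k
    have hav := ratioTendsto_average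
      (x := fun i M => PowerSeries.coeff k (stepLogDeriv (fun m => A m M) i)) (B := B k)
      (fun i M => hB k _ (fun m => (hA m M).le) i) ht
      (L := fun s => ∫ φ, starRingEnd ℂ (arcPoint ‖α s‖ φ) ^ (k + 1) ∂angleMeasure) (by
        filter_upwards [hlim, ae_restrict_mem measurableSet_Icc] with s hs hst
        exact ratioTendsto_coeff_stepLogDeriv_arcPoint (hα s hst) hs k) n N hn hN hnN
    rw [integral_averageArcMeasure ht hr hαr hα]
    -- Replacing the last coefficient by `β` costs at most `D / n`, so the limit does not depend on
    -- `β`.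
    have hdiff := squeeze_zero_norm
      (fun j => hD (fun m => A m (N j)) (fun m => (hA m (N j)).le) β hβ (n j))
      ((tendsto_const_div_atTop_nhds_zero_nat D).comp hn)
    simpa using hdiff.add hav

end
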